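/- For all $\alpha,\delta\in(0,1)$ there is a constant $\rho_0=\rho_0(\alpha,\delta)>0$, depending only on $\alpha$ and $\delta$, such that the following holds for every $x_0\in\mathbb{R}^3$, every unit vector $\omega\in\mathbb{S}^2$ and every $0<\rho\le\rho_0$. Let $E\subset\mathbb{R}^3$ be a bounded $C^2$-regular set (near each point of its boundary $\partial E$, the boundary is a $C^2$ hypersurface and $E$ lies locally on one side of it), and let $H_E$ be the mean curvature of $\partial E$, i.e. the sum of the principal curvatures with respect to the outer unit normal. If $$\frac14\int_{\partial E}H_E^2\,d\mathcal{H}^2\le 8\pi-\delta\qquad\text{and}\qquad \partial E\cap B_{2\rho}(x_0)\subset\{x\in\mathbb{R}^3:\ |(x-x_0)\cdot\omega|\le\rho^{1+\alpha}\},$$ then $$\mathcal{H}^2\big(\partial E\cap B_\rho(x_0)\big)\le\Big(2\pi-\frac{\delta}{6}\Big)\rho^2 .$$ Here $B_r(x_0)$ denotes the open ball and $\mathcal{H}^2$ the two-dimensional Hausdorff measure, normalized to agree with area on planes. -/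

import Mathlib

open MeasureTheory Topology Set
open scoped ENNReal RealInnerProductSpace

namespace C2Set

/-- Euclidean three-space. -/
abbrev R3 : Type := EuclideanSpace ℝ (Fin 3)

/-- `f` is a `C²` defining function of the set `E` near the boundary point `x`: `f` is `C²` in a
neighbourhood of `x`, vanishes at `x` with non-zero gradient, and near `x` the set `E` contains
`{f < 0}` and does not meet `{f > 0}`. (Hence near `x` the boundary of `E` is the level set
`{f = 0}`, a `C²` graph over its tangent plane with `E` on one side, and `∇ f` points out of
`E`. No convention is made on which boundary points belong to `E`.) -/
structure IsDefiningFunctionAt (E : Set R3) (x : R3) (f : R3 → ℝ) : Prop where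
  contDiffAt : ContDiffAt ℝ 2 f x
  eq_zero : f x = 0
  gradient_ne_zero : gradient f x ≠ 0
  mem_of_neg : ∀ᶠ y in 𝓝 x, f y < 0 → y ∈ E
  notMem_of_pos : ∀ᶠ y in 𝓝 x, 0 < f y → y ∉ E

/-- `E` is a `C²`-regular set: near each of its boundary points it is one side of a regular
`C²` hypersurface. -/
def IsC2Regular (E : Set R3) : Prop :=
  ∀ x ∈ frontier E, ∃ f : R3 → ℝ, IsDefiningFunctionAt E x f

/-- The unit normal `∇ f / |∇ f|` to the level sets of `f`. If `f` is a defining function of `E`,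
this is the outer unit normal of `E` along the boundary of `E`. -/
noncomputable def unitNormal (f : R3 → ℝ) (y : R3) : R3 :=
  ‖gradient f y‖⁻¹ • gradient f y

/-- The tangent plane at `x` to the level set of `f` through `x`. -/
noncomputable def tangentPlane (f : R3 → ℝ) (x : R3) : Submodule ℝ R3 :=
  (ℝ ∙ gradient f x)ᗮ

/-- The Weingarten map (differential of the unit normal) at `x` of the level set of `f` through
`x`, as an endomorphism of the tangent plane. Its eigenvalues are the principal curvatures, with
the sign for which they are non-negative for convex sublevel sets. -/
noncomputable def weingartenMap (f : R3 → ℝ) (x : R3) :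
    tangentPlane f x →ₗ[ℝ] tangentPlane f x :=
  (tangentPlane f x).orthogonalProjectionOnto.toLinearMap ∘ₗ
    (fderiv ℝ (unitNormal f) x).toLinearMap ∘ₗ (tangentPlane f x).subtype

open Classical in
/-- The mean curvature of the boundary of `E` at `x` with respect to the outer unit normal: the
sum of the principal curvatures, that is, the trace of the Weingarten map. It is computed from a
`C²` defining function of `E` at `x`; its value does not depend on which one is taken. (It is `0`
where there is none, which does not happen on the boundary of a `C²`-regular set.) -/
noncomputable def meanCurvature (E : Set R3) (x : R3) : ℝ :=
  if h : ∃ f : R3 → ℝ, IsDefiningFunctionAt E x f then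
    LinearMap.trace ℝ (tangentPlane h.choose x) (weingartenMap h.choose x)
  else 0

/-- The Willmore energy `(1/4) ∫_{∂E} H_E² dℋ²`, as an element of `[0, ∞]`. Here `μHE[2]` is the
two-dimensional Hausdorff measure with the Euclidean normalization (it agrees with area on
planes). -/
noncomputable def willmoreEnergy (E : Set R3) : ℝ≥0∞ :=
  4⁻¹ * ∫⁻ x in frontier E, ENNReal.ofReal (meanCurvature E x ^ 2) ∂(μHE[2])

end C2Set

/-!
Write `Σ` for the boundary of `E`, `n` for its outer normal, `H` for its mean curvature and `Q` for
`∫_Σ H²`. The bound is Simon's monotonicity formula, in which the flatness hypothesis makes the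
boundary term small.

Everything rests on the first variation formula
`∫_Σ (tr_Σ DX - H ⟪X, n⟫) = 0` for `C¹` vector fields `X`
(`IsC2Regular.integral_firstVariationDensity`). By a partition of unity it may be checked in a chart
`Φ`, where the integrand, multiplied by the area element, is `∓ (∂₁ det (X, n, ∂₂Φ) - ∂₂ det (X, n,
∂₁Φ))` (`tripleProduct_exterior_derivative`), whose integral vanishes. That the Hausdorff measure
has this area element in a chart is the area formula
`map_restrict_euclideanHausdorffMeasure_image`, deduced from the linear case because a `C¹`
immersion is locally bi-Lipschitz close to its derivative, with constants close to one.

The radial field `(z - x₀) / max (|z - x₀|², ρ²)`, smoothed to class `C¹`, and the inequality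
`H k ≤ 2 k² + H² / 8` give
`area (Σ ∩ B_ρ) ≤ ρ² Q / 16 + (1 / 2) ∫_{Σ ∩ B_{3ρ/2}} |H| |⟪z - x₀, n⟫|`
(`IsC2Regular.area_le_sharp`), and also the crude bound `area (Σ ∩ B_r) ≤ (3 / 4) r² Q`
(`IsC2Regular.area_le`). Since `Q / 16 ≤ 2π - δ / 4`, it remains to bound the last integral by a
small multiple of `ρ²`. The field `ζ ⟪z - x₀, ω⟫ ω`, with a cutoff `ζ` supported in `B_{2ρ}`, shows
that `∫_{Σ ∩ B_{3ρ/2}} (1 - ⟪ω, n⟫²)` is small compared with `ρ²` when `Σ` lies in a thin slab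
(`IsC2Regular.tilt_le`). Then
`z - x₀` is nearly tangential, and the Cauchy-Schwarz inequality finishes the proof
(`IsC2Regular.integral_abs_mul_abs_le`).
-/

/-! ### The area formula for parametrized submanifolds -/

/-- Comparison of the measures of two images of the same set. Neither map has to be injective: the
hypothesis forces `g` to factor through `h`. -/
theorem euclideanHausdorffMeasure_image_le_of_edist_le {T X Y : Type*} [EMetricSpace X]
    [MeasurableSpace X] [BorelSpace X] [EMetricSpace Y] [MeasurableSpace Y] [BorelSpace Y]
    (d : ℕ) {A : Set T} {g : T → X} {h : T → Y} {c : NNReal}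
    (H : ∀ y ∈ A, ∀ z ∈ A, edist (g y) (g z) ≤ c * edist (h y) (h z)) :
    μHE[d] (g '' A) ≤ (c : ℝ≥0∞) ^ d * μHE[d] (h '' A) := by
  classical
  rcases A.eq_empty_or_nonempty with rfl | ⟨a, ha⟩
  · simp
  have : Nonempty T := ⟨a⟩
  set k := Function.invFunOn h A
  have hk : ∀ y ∈ A, k (h y) ∈ A ∧ h (k (h y)) = h y := fun y hy =>
    ⟨Function.invFunOn_mem ⟨y, hy, rfl⟩, Function.invFunOn_eq ⟨y, hy, rfl⟩⟩
  have hlip : LipschitzOnWith c (g ∘ k) (h '' A) := by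
    rintro _ ⟨y, hy, rfl⟩ _ ⟨z, hz, rfl⟩
    have := H _ (hk y hy).1 _ (hk z hz).1
    rwa [(hk y hy).2, (hk z hz).2] at this
  have himg : g '' A = (g ∘ k) '' (h '' A) := by
    rw [image_image]
    refine image_congr fun y hy => ?_
    have := H _ (hk y hy).1 _ hy
    rw [(hk y hy).2, edist_self, mul_zero, nonpos_iff_eq_zero, edist_eq_zero] at this
    exact this.symm
  have := hlip.hausdorffMeasure_image_le (d := d) (by positivity)
  rw [himg]
  simp only [Measure.euclideanHausdorffMeasure_def, Measure.smul_apply, ENNReal.smul_def,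
    smul_eq_mul]
  calc _ ≤ _ := mul_le_mul_right this _
    _ = _ := by rw [ENNReal.rpow_natCast]; ring

section AreaFormula

variable {U V : Type*} [NormedAddCommGroup U] [InnerProductSpace ℝ U] [FiniteDimensional ℝ U]
  [MeasurableSpace U] [BorelSpace U] [NormedAddCommGroup V] [InnerProductSpace ℝ V]
  [MeasurableSpace V] [BorelSpace V]

open Module

/-- Near a point an immersion distorts measure as its derivative there does, up to a factor
arbitrarily close to one. -/
theorem HasStrictFDerivAt.exists_nhds_euclideanHausdorffMeasure_image {Φ : U → V} {L : U →L[ℝ] V}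
    {q : U} (hΦ : HasStrictFDerivAt Φ L q) (hL : Function.Injective L) {c : NNReal} (hc : 1 < c) :
    ∃ W ∈ 𝓝 q, ∀ A ⊆ W,
      μHE[finrank ℝ U] (Φ '' A) ≤ (c : ℝ≥0∞) ^ finrank ℝ U *
        (ENNReal.ofReal L.toLinearMap.normDet * volume A) ∧
      ENNReal.ofReal L.toLinearMap.normDet * volume A ≤
        (c : ℝ≥0∞) ^ finrank ℝ U * μHE[finrank ℝ U] (Φ '' A) := by
  obtain ⟨K, hK, hanti⟩ := L.toLinearMap.exists_antilipschitzWith (LinearMap.ker_eq_bot.2 hL)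
  have hcR : (1 : ℝ) < c := by exact_mod_cast hc
  set ε : NNReal := (1 - c⁻¹) / K with hε
  have hKε : (K : ℝ) * ε = 1 - (c : ℝ)⁻¹ := by
    have h1 : c⁻¹ ≤ 1 := inv_le_one_of_one_le₀ hc.le
    rw [hε]; push_cast [NNReal.coe_sub h1]
    field_simp
  have hεpos : 0 < ε := by
    refine div_pos (tsub_pos_of_lt ?_) hK
    exact inv_lt_one_of_one_lt₀ hc
  obtain ⟨W, hW, happ⟩ := hΦ.approximates_deriv_on_nhds (c := ε) (Or.inr hεpos)
  have key : ∀ y ∈ W, ∀ z ∈ W, ‖Φ y - Φ z - L (y - z)‖ ≤ (1 - (c : ℝ)⁻¹) * ‖L (y - z)‖ := by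
    intro y hy z hz
    have h1 := happ y hy z hz
    have h2 : ‖y - z‖ ≤ K * ‖L (y - z)‖ := by
      have := hanti.le_mul_dist y z
      rwa [dist_eq_norm, dist_eq_norm, ContinuousLinearMap.coe_coe, ← map_sub] at this
    calc _ ≤ ε * ‖y - z‖ := h1
      _ ≤ ε * (K * ‖L (y - z)‖) := by gcongr
      _ = (K * ε) * ‖L (y - z)‖ := by ring
      _ = _ := by rw [hKε]
  have hcinv : (0 : ℝ) < (c : ℝ)⁻¹ := by positivity
  have hcc : (1 : ℝ) ≤ c + (c : ℝ)⁻¹ - 1 := by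
    have : (c : ℝ) * (c : ℝ)⁻¹ = 1 := by field_simp
    nlinarith
  refine ⟨W, hW, fun A hA => ?_⟩
  rw [← LinearMap.euclideanHausdorffMeasure_image_eq_normDet_mul_volume]
  constructor
  · apply euclideanHausdorffMeasure_image_le_of_edist_le
    intro y hy z hz
    rw [edist_nndist, edist_nndist, ← ENNReal.coe_mul, ENNReal.coe_le_coe, ← NNReal.coe_le_coe]
    push_cast
    rw [dist_eq_norm, dist_eq_norm, ← map_sub]
    have h1 := key y (hA hy) z (hA hz)
    have h2 := norm_add_le (Φ y - Φ z - L (y - z)) (L (y - z))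
    rw [sub_add_cancel] at h2
    nlinarith [norm_nonneg (L (y - z))]
  · apply euclideanHausdorffMeasure_image_le_of_edist_le
    intro y hy z hz
    rw [edist_nndist, edist_nndist, ← ENNReal.coe_mul, ENNReal.coe_le_coe, ← NNReal.coe_le_coe]
    push_cast
    rw [dist_eq_norm, dist_eq_norm, ← map_sub]
    have h1 := key y (hA hy) z (hA hz)
    have h2 := norm_sub_le (Φ y - Φ z) (Φ y - Φ z - L (y - z))
    rw [sub_sub_cancel] at h2
    have h3 : (c : ℝ)⁻¹ * ‖L (y - z)‖ ≤ ‖Φ y - Φ z‖ := by linarith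
    rwa [inv_mul_le_iff₀ (by positivity)] at h3

/-- An inequality between measures that holds locally holds globally, by the Lindelöf property. -/
theorem MeasureTheory.Measure.le_mul_of_forall_nhds {X : Type*} [TopologicalSpace X]
    [SecondCountableTopology X] [MeasurableSpace X] [OpensMeasurableSpace X] {ν lam : Measure X}
    {k : ℝ≥0∞} {A : Set X} (hA : MeasurableSet A)
    (h : ∀ x ∈ A, ∃ W ∈ 𝓝 x, ∀ B ⊆ W ∩ A, MeasurableSet B → ν B ≤ k * lam B) :
    ν A ≤ k * lam A := by
  classical
  choose! W hW hB using h
  obtain ⟨t, htA, htc, ht⟩ := TopologicalSpace.countable_cover_nhdsWithin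
    (f := fun x => interior (W x)) (s := A)
    fun x hx => mem_nhdsWithin_of_mem_nhds (interior_mem_nhds.2 (hW x hx))
  rcases t.eq_empty_or_nonempty with rfl | hne
  · simp only [mem_empty_iff_false, iUnion_of_empty, iUnion_empty, subset_empty_iff] at ht
    simp [ht]
  obtain ⟨e, rfl⟩ := htc.exists_eq_range hne
  set S : ℕ → Set X := fun n => A ∩ disjointed (fun n => interior (W (e n))) n with hS
  have hSm : ∀ n, MeasurableSet (S n) := fun n =>
    hA.inter (MeasurableSet.disjointed (fun n => isOpen_interior.measurableSet) n)
  have hSd : Pairwise (Function.onFun Disjoint S) := fun i j hij =>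
    ((disjoint_disjointed _ hij).mono inter_subset_right inter_subset_right)
  have hSU : A = ⋃ n, S n := by
    rw [← inter_iUnion, iUnion_disjointed, eq_comm, inter_eq_left]
    simpa using ht
  have hSB : ∀ n, ν (S n) ≤ k * lam (S n) := fun n => by
    refine hB (e n) (htA ⟨n, rfl⟩) _ (fun x hx => ⟨?_, hx.1⟩) (hSm n)
    exact interior_subset (disjointed_subset (fun n => interior (W (e n))) n hx.2)
  calc ν A = ∑' n, ν (S n) := by
        conv_lhs => rw [hSU]
        exact measure_iUnion hSd hSm
    _ ≤ ∑' n, k * lam (S n) := ENNReal.tsum_le_tsum hSB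
    _ = k * lam A := by
        rw [ENNReal.tsum_mul_left]
        conv_rhs => rw [hSU]
        rw [measure_iUnion hSd hSm]

omit [MeasurableSpace U] [BorelSpace U] [MeasurableSpace V] [BorelSpace V] in
theorem ContinuousLinearMap.continuous_normDet :
    Continuous fun L : U →L[ℝ] V => L.toLinearMap.normDet := by
  have : (fun L : U →L[ℝ] V => L.toLinearMap.normDet) = fun L : U →L[ℝ] V =>
      √((Matrix.gram ℝ (fun i => L (stdOrthonormalBasis ℝ U i))).det) := by
    funext L
    have h := L.toLinearMap.normDet_sq_eq_det_gram (stdOrthonormalBasis ℝ U)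
    rw [RCLike.ofReal_real_eq_id, id] at h
    rw [eq_comm]
    simp only [ContinuousLinearMap.coe_coe] at h
    rw [← h]
    exact Real.sqrt_sq L.toLinearMap.normDet_nonneg
  rw [this]
  refine Real.continuous_sqrt.comp (Continuous.matrix_det ?_)
  refine continuous_matrix fun i j => ?_
  simp only [Matrix.gram_apply]
  fun_prop

/-- The area formula for an injective `C¹` immersion `Φ` of an open set `O`, with a measurable left
inverse `P`: transported to the parameter domain by `P`, the Hausdorff measure of the image has the
density `normDet (Φ')`. -/
theorem map_restrict_euclideanHausdorffMeasure_image {Φ : U → V} {Φ' : U → U →L[ℝ] V} {P : V → U}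
    {O : Set U} (hO : IsOpen O) (hP : Measurable P) (hPΦ : ∀ q ∈ O, P (Φ q) = q)
    (hΦ : ∀ q ∈ O, HasStrictFDerivAt Φ (Φ' q) q) (hinj : ∀ q ∈ O, Function.Injective (Φ' q))
    (hcont : ContinuousOn Φ' O) :
    (μHE[finrank ℝ U].restrict (Φ '' O)).map P =
      (volume.restrict O).withDensity fun q => ENNReal.ofReal (Φ' q).toLinearMap.normDet := by
  set J : U → ℝ := fun q => (Φ' q).toLinearMap.normDet with hJ
  set d := finrank ℝ U
  have hJc : ContinuousOn J O := ContinuousLinearMap.continuous_normDet.comp_continuousOn hcont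
  have hJpos : ∀ q ∈ O, 0 < J q := fun q hq =>
    lt_of_le_of_ne (LinearMap.normDet_nonneg _) (Ne.symm (((Φ' q).toLinearMap.normDet_ne_zero_tfae.out 0 4).2
      (hinj q hq)))
  have hν : ∀ A, MeasurableSet A → (μHE[d].restrict (Φ '' O)).map P A = μHE[d] (Φ '' (A ∩ O)) := by
    intro A hA
    rw [Measure.map_apply hP hA, Measure.restrict_apply (hP hA)]
    congr 1
    ext y
    constructor
    · rintro ⟨h1, q, hq, rfl⟩
      rw [mem_preimage, hPΦ q hq] at h1
      exact ⟨q, ⟨h1, hq⟩, rfl⟩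
    · rintro ⟨q, ⟨h1, h2⟩, rfl⟩
      exact ⟨by rwa [mem_preimage, hPΦ q h2], q, h2, rfl⟩
  have hlam : ∀ A, MeasurableSet A → ((volume.restrict O).withDensity fun q => ENNReal.ofReal (J q)) A
      = ∫⁻ q in A ∩ O, ENNReal.ofReal (J q) := by
    intro A hA
    rw [withDensity_apply _ hA, Measure.restrict_restrict hA]
  have main : ∀ c : NNReal, 1 < c → ∀ q ∈ O, ∃ W ∈ 𝓝 q, ∀ B ⊆ W ∩ O, MeasurableSet B →
      μHE[d] (Φ '' B) ≤ (c : ℝ≥0∞) ^ (d + 1) * ∫⁻ q in B, ENNReal.ofReal (J q) ∧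
      ∫⁻ q in B, ENNReal.ofReal (J q) ≤ (c : ℝ≥0∞) ^ (d + 1) * μHE[d] (Φ '' B) := by
    intro c hc q hq
    have hcR : (1 : ℝ) < c := by exact_mod_cast hc
    obtain ⟨W, hW, hB⟩ := (hΦ q hq).exists_nhds_euclideanHausdorffMeasure_image (hinj q hq) hc
    have hJq : ContinuousAt J q := hJc.continuousAt (hO.mem_nhds hq)
    have h1 : ∀ᶠ p in 𝓝 q, J p < c * J q :=
      hJq.eventually_lt continuousAt_const (by nlinarith [hJpos q hq])
    have h2 : ∀ᶠ p in 𝓝 q, J q < c * J p :=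
      continuousAt_const.eventually_lt (continuousAt_const.mul hJq) (by nlinarith [hJpos q hq])
    refine ⟨W ∩ {p | J p < c * J q ∧ J q < c * J p}, Filter.inter_mem hW (h1.and h2), ?_⟩
    intro B hBW hBm
    obtain ⟨h3, h4⟩ := hB B fun x hx => (hBW hx).1.1
    have h5 : ∫⁻ q in B, ENNReal.ofReal (J q) ≤ c * (ENNReal.ofReal (J q) * volume B) := by
      rw [← mul_assoc, ← setLIntegral_const]
      refine setLIntegral_mono measurable_const fun p hp => ?_
      rw [← ENNReal.ofReal_coe_nnreal, ← ENNReal.ofReal_mul (by positivity)]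
      exact ENNReal.ofReal_le_ofReal (hBW hp).1.2.1.le
    have h6 : ENNReal.ofReal (J q) * volume B ≤ c * ∫⁻ q in B, ENNReal.ofReal (J q) := by
      rw [← setLIntegral_const, ← lintegral_const_mul' _ _ ENNReal.coe_ne_top]
      refine setLIntegral_mono' hBm fun p hp => ?_
      rw [← ENNReal.ofReal_coe_nnreal, ← ENNReal.ofReal_mul (by positivity)]
      exact ENNReal.ofReal_le_ofReal (hBW hp).1.2.2.le
    constructor
    · calc _ ≤ _ := h3
        _ ≤ (c : ℝ≥0∞) ^ d * (c * ∫⁻ q in B, ENNReal.ofReal (J q)) := by gcongr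
        _ = _ := by ring
    · calc _ ≤ _ := h5
        _ ≤ c * ((c : ℝ≥0∞) ^ d * μHE[d] (Φ '' B)) := by gcongr
        _ = _ := by ring
  have lim : ∀ a b : ℝ≥0∞, (∀ c : NNReal, 1 < c → a ≤ (c : ℝ≥0∞) ^ (d + 1) * b) → a ≤ b := by
    intro a b hab
    have h1 : Filter.Tendsto (fun c : NNReal => (c : ℝ≥0∞) ^ (d + 1) * b) (𝓝[>] 1)
        (𝓝 (((1 : NNReal) : ℝ≥0∞) ^ (d + 1) * b)) := by
      refine ENNReal.Tendsto.mul_const ?_ (Or.inl (by simp))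
      refine Filter.Tendsto.mono_left ?_ nhdsWithin_le_nhds
      exact ((ENNReal.continuous_pow (d + 1)).comp ENNReal.continuous_coe).tendsto 1
    simp only [ENNReal.coe_one, one_pow, one_mul] at h1
    exact ge_of_tendsto h1 (eventually_mem_nhdsWithin.mono fun c hc => hab c hc)
  ext A hA
  have hAO := hA.inter hO.measurableSet
  have hsub : ∀ B ⊆ A ∩ O, B ∩ O = B := fun B hB => inter_eq_left.2 fun x hx => (hB hx).2
  have hA' : ∀ (μ : Measure U), μ Oᶜ = 0 → μ A = μ (A ∩ O) := fun μ hμ =>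
    (measure_inter_conull hμ).symm
  have hE : ∀ B ⊆ A ∩ O, MeasurableSet B →
      (μHE[d].restrict (Φ '' O)).map P B = μHE[d] (Φ '' B) := fun B hB hBm => by
    rw [hν B hBm, hsub B hB]
  have hE' : ∀ B ⊆ A ∩ O, MeasurableSet B →
      ((volume.restrict O).withDensity fun q => ENNReal.ofReal (J q)) B
        = ∫⁻ q in B, ENNReal.ofReal (J q) := fun B hB hBm => by
    rw [hlam B hBm, hsub B hB]
  rw [hν A hA, hlam A hA, ← hE _ subset_rfl hAO, ← hE' _ subset_rfl hAO]
  apply le_antisymm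
  · refine lim _ _ fun c hc => Measure.le_mul_of_forall_nhds hAO fun q hq => ?_
    obtain ⟨W, hW, hWB⟩ := main c hc q hq.2
    refine ⟨W, hW, fun B hB hBm => ?_⟩
    have hBA : B ⊆ A ∩ O := hB.trans inter_subset_right
    rw [hE B hBA hBm, hE' B hBA hBm]
    exact (hWB B (fun x hx => ⟨(hB hx).1, (hB hx).2.2⟩) hBm).1
  · refine lim _ _ fun c hc => Measure.le_mul_of_forall_nhds hAO fun q hq => ?_
    obtain ⟨W, hW, hWB⟩ := main c hc q hq.2
    refine ⟨W, hW, fun B hB hBm => ?_⟩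
    have hBA : B ⊆ A ∩ O := hB.trans inter_subset_right
    rw [hE B hBA hBm, hE' B hBA hBm]
    exact (hWB B (fun x hx => ⟨(hB hx).1, (hB hx).2.2⟩) hBm).2

end AreaFormula

/-! ### Triple products and tangential traces -/

namespace C2Set

/-- The model of the parameter plane of a surface chart. -/
abbrev R2 : Type := EuclideanSpace ℝ (Fin 2)

/-- The triple product `det (a, b, c)` of three vectors of `ℝ³`. -/
def tripleProduct (a b c : R3) : ℝ :=
  a 0 * (b 1 * c 2 - b 2 * c 1) - a 1 * (b 0 * c 2 - b 2 * c 0) + a 2 * (b 0 * c 1 - b 1 * c 0)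

/-- The trace of `A` over the plane orthogonal to the unit vector `n`. For `A` the derivative of a
vector field and `n` the unit normal of a surface, this is the tangential divergence of the
field. -/
noncomputable def tangentialTrace (A : R3 →L[ℝ] R3) (n : R3) : ℝ :=
  LinearMap.trace ℝ R3 A.toLinearMap - ⟪A n, n⟫

theorem inner_eq_coord (a b : R3) : ⟪a, b⟫ = a 0 * b 0 + a 1 * b 1 + a 2 * b 2 := by
  simp [PiLp.inner_apply, Fin.sum_univ_three]; ring

theorem trace_eq_coord (A : R3 →L[ℝ] R3) : LinearMap.trace ℝ R3 A.toLinearMap =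
    A (EuclideanSpace.single 0 1) 0 + A (EuclideanSpace.single 1 1) 1
      + A (EuclideanSpace.single 2 1) 2 := by
  rw [A.toLinearMap.trace_eq_sum_inner (EuclideanSpace.basisFun (Fin 3) ℝ), Fin.sum_univ_three]
  simp [EuclideanSpace.inner_single_left]

theorem apply_eq_coord (A : R3 →L[ℝ] R3) (v : R3) (i : Fin 3) :
    A v i = v 0 * A (EuclideanSpace.single 0 1) i + v 1 * A (EuclideanSpace.single 1 1) i
      + v 2 * A (EuclideanSpace.single 2 1) i := by
  have hv : v = v 0 • EuclideanSpace.single 0 (1 : ℝ) + v 1 • EuclideanSpace.single 1 (1 : ℝ)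
      + v 2 • EuclideanSpace.single 2 (1 : ℝ) := by
    ext j; fin_cases j <;> simp
  conv_lhs => rw [hv]
  simp

/-- Three vectors of the plane `n^⊥` are linearly dependent. -/
theorem tripleProduct_eq_zero {n a b c : R3} (hn : ‖n‖ = 1) (ha : ⟪a, n⟫ = 0) (hb : ⟪b, n⟫ = 0)
    (hc : ⟪c, n⟫ = 0) : tripleProduct a b c = 0 := by
  have hn2 : ⟪n, n⟫ = 1 := by rw [real_inner_self_eq_norm_sq, hn]; norm_num
  rw [inner_eq_coord] at *
  unfold tripleProduct
  -- Cramer's rule: the determinant times each coordinate of `n` vanishes.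
  have h0 : tripleProduct a b c * n 0 = 0 := by
    unfold tripleProduct
    linear_combination (b 1 * c 2 - b 2 * c 1) * ha - (a 1 * c 2 - a 2 * c 1) * hb
      + (a 1 * b 2 - a 2 * b 1) * hc
  have h1 : tripleProduct a b c * n 1 = 0 := by
    unfold tripleProduct
    linear_combination (b 2 * c 0 - b 0 * c 2) * ha - (a 2 * c 0 - a 0 * c 2) * hb
      + (a 2 * b 0 - a 0 * b 2) * hc
  have h2 : tripleProduct a b c * n 2 = 0 := by
    unfold tripleProduct
    linear_combination (b 0 * c 1 - b 1 * c 0) * ha - (a 0 * c 1 - a 1 * c 0) * hb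
      + (a 0 * b 1 - a 1 * b 0) * hc
  unfold tripleProduct at h0 h1 h2
  linear_combination n 0 * h0 + n 1 * h1 + n 2 * h2 - (a 0 * (b 1 * c 2 - b 2 * c 1) -
    a 1 * (b 0 * c 2 - b 2 * c 0) + a 2 * (b 0 * c 1 - b 1 * c 0)) * hn2

theorem tripleProduct_eq_inner_mul {n a b : R3} (hn : ‖n‖ = 1) (ha : ⟪a, n⟫ = 0)
    (hb : ⟪b, n⟫ = 0) (v : R3) :
    tripleProduct v a b = ⟪v, n⟫ * tripleProduct n a b := by
  have h := tripleProduct_eq_zero (a := v - ⟪v, n⟫ • n) hn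
    (by rw [inner_sub_left, inner_smul_left, real_inner_self_eq_norm_sq, hn]; simp) ha hb
  unfold tripleProduct at *
  simp only [PiLp.sub_apply, PiLp.smul_apply, smul_eq_mul] at h
  linear_combination h

/-- For `a`, `b` spanning the plane orthogonal to `n` this expresses the trace over that plane as
the derivative of the area form. -/
theorem tangentialTrace_mul_tripleProduct (A : R3 →L[ℝ] R3) {n a b : R3} (hn : ‖n‖ = 1)
    (ha : ⟪a, n⟫ = 0) (hb : ⟪b, n⟫ = 0) :
    tangentialTrace A n * tripleProduct n a b =
      tripleProduct n (A a) b + tripleProduct n a (A b) := by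
  have h1 : LinearMap.trace ℝ R3 A.toLinearMap * tripleProduct n a b =
      tripleProduct (A n) a b + tripleProduct n (A a) b + tripleProduct n a (A b) := by
    rw [trace_eq_coord]
    unfold tripleProduct
    simp only [apply_eq_coord A a, apply_eq_coord A b, apply_eq_coord A n]
    ring
  rw [tripleProduct_eq_inner_mul hn ha hb (A n)] at h1
  rw [tangentialTrace]
  linear_combination h1

theorem tripleProduct_sq {n a b : R3} (hn : ‖n‖ = 1) (ha : ⟪a, n⟫ = 0) (hb : ⟪b, n⟫ = 0) :
    tripleProduct n a b ^ 2 = ⟪a, a⟫ * ⟪b, b⟫ - ⟪a, b⟫ ^ 2 := by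
  have hn2 : ⟪n, n⟫ = 1 := by rw [real_inner_self_eq_norm_sq, hn]; norm_num
  have h : tripleProduct n a b ^ 2 = ⟪n, n⟫ * (⟪a, a⟫ * ⟪b, b⟫ - ⟪a, b⟫ ^ 2)
      - ⟪a, n⟫ * (⟪a, n⟫ * ⟪b, b⟫ - ⟪b, n⟫ * ⟪a, b⟫)
      + ⟪b, n⟫ * (⟪a, n⟫ * ⟪a, b⟫ - ⟪b, n⟫ * ⟪a, a⟫) := by
    simp only [inner_eq_coord]
    unfold tripleProduct
    ring
  rw [h, hn2, ha, hb]; ring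

theorem abs_tripleProduct_eq_normDet {n : R3} (hn : ‖n‖ = 1) (L : R2 →L[ℝ] R3)
    (hL : ∀ v, ⟪L v, n⟫ = 0) :
    |tripleProduct n (L (EuclideanSpace.single 0 1)) (L (EuclideanSpace.single 1 1))| =
      L.toLinearMap.normDet := by
  have h := L.toLinearMap.normDet_sq_eq_det_gram (EuclideanSpace.basisFun (Fin 2) ℝ)
  rw [RCLike.ofReal_real_eq_id, id, Matrix.det_fin_two] at h
  simp only [Matrix.gram_apply, EuclideanSpace.basisFun_apply, ContinuousLinearMap.coe_coe] at h
  rw [← abs_of_nonneg L.toLinearMap.normDet_nonneg, ← sq_eq_sq_iff_abs_eq_abs, h,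
    tripleProduct_sq hn (hL _) (hL _), real_inner_comm (L (EuclideanSpace.single 0 1))
      (L (EuclideanSpace.single 1 1))]
  ring

theorem tripleProduct_ne_zero {n : R3} (hn : ‖n‖ = 1) {L : R2 →L[ℝ] R3}
    (hL : ∀ v, ⟪L v, n⟫ = 0) (hinj : Function.Injective L) :
    tripleProduct n (L (EuclideanSpace.single 0 1)) (L (EuclideanSpace.single 1 1)) ≠ 0 := by
  rw [← abs_ne_zero, abs_tripleProduct_eq_normDet hn L hL]
  exact (L.toLinearMap.normDet_ne_zero_tfae.out 0 4).2 hinj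

/-- The pointwise identity behind the first variation formula. With `X` a vector field of
derivative `A`, `n` the normal field of derivative `B`, and `a`, `b` the coordinate vectors of a
chart, the left hand side is `∂₁ det (X, n, b) - ∂₂ det (X, n, a)`. -/
theorem tripleProduct_exterior_derivative (A B : R3 →L[ℝ] R3) (X : R3) {n a b : R3}
    (hn : ‖n‖ = 1) (ha : ⟪a, n⟫ = 0) (hb : ⟪b, n⟫ = 0) (hBa : ⟪B a, n⟫ = 0) (hBb : ⟪B b, n⟫ = 0) :
    (tripleProduct (A a) n b + tripleProduct X (B a) b) -
      (tripleProduct (A b) n a + tripleProduct X (B b) a) =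
    -((tangentialTrace A n - tangentialTrace B n * ⟪X, n⟫) * tripleProduct n a b) := by
  have h1 := tangentialTrace_mul_tripleProduct A hn ha hb
  have h2 := tangentialTrace_mul_tripleProduct B hn ha hb
  have h3 := tripleProduct_eq_inner_mul hn hBa hb X
  have h4 := tripleProduct_eq_inner_mul hn hBb ha X
  rw [h3, h4]
  have e1 : tripleProduct (A a) n b = - tripleProduct n (A a) b := by unfold tripleProduct; ring
  have e2 : tripleProduct (A b) n a = tripleProduct n a (A b) := by unfold tripleProduct; ring
  have e3 : tripleProduct n (B b) a = -tripleProduct n a (B b) := by unfold tripleProduct; ring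
  rw [e1, e2, e3]
  linear_combination h1 - ⟪X, n⟫ * h2

/-! ### Defining functions, normals and charts -/

theorem norm_unitNormal {f : R3 → ℝ} {x : R3} (h : gradient f x ≠ 0) : ‖unitNormal f x‖ = 1 := by
  rw [unitNormal, norm_smul, norm_inv, norm_norm, inv_mul_cancel₀ (norm_ne_zero_iff.2 h)]

theorem inner_unitNormal (f : R3 → ℝ) (x v : R3) :
    ⟪v, unitNormal f x⟫ = ‖gradient f x‖⁻¹ * fderiv ℝ f x v := by
  rw [unitNormal, inner_smul_right, inner_gradient_right]; simp

theorem contDiffAt_gradient {f : R3 → ℝ} {x : R3} (h : ContDiffAt ℝ 2 f x) :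
    ContDiffAt ℝ 1 (gradient f) x := by
  have : gradient f = fun y => (InnerProductSpace.toDual ℝ R3).symm (fderiv ℝ f y) := rfl
  rw [this]
  exact (InnerProductSpace.toDual ℝ R3).symm.toContinuousLinearEquiv.contDiff.contDiffAt.comp x
    (h.fderiv_right (by norm_num))

theorem contDiffAt_unitNormal {f : R3 → ℝ} {x : R3} (h : ContDiffAt ℝ 2 f x)
    (h0 : gradient f x ≠ 0) : ContDiffAt ℝ 1 (unitNormal f) x := by
  have h1 := contDiffAt_gradient h
  exact ((h1.norm ℝ h0).inv (norm_ne_zero_iff.2 h0)).smul h1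

/-- The trace of the Weingarten map, in terms of endomorphisms of the whole space. -/
theorem trace_weingartenMap {f : R3 → ℝ} {x : R3} (h0 : gradient f x ≠ 0) :
    LinearMap.trace ℝ (tangentPlane f x) (weingartenMap f x) =
      tangentialTrace (fderiv ℝ (unitNormal f) x) (unitNormal f x) := by
  set A := fderiv ℝ (unitNormal f) x
  set n := unitNormal f x with hn
  have hn1 : ‖n‖ = 1 := norm_unitNormal h0
  have hspan : (ℝ ∙ gradient f x) = ℝ ∙ n := by
    rw [hn, unitNormal]
    exact (Submodule.span_singleton_smul_eq (IsUnit.mk0 _ (inv_ne_zero (norm_ne_zero_iff.2 h0)))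
      _).symm
  rw [weingartenMap, LinearMap.trace_comp_comm']
  have hop : (A.toLinearMap ∘ₗ (tangentPlane f x).subtype) ∘ₗ
      (tangentPlane f x).orthogonalProjectionOnto.toLinearMap =
      A.toLinearMap - (InnerProductSpace.rankOne ℝ (A n) n).toLinearMap := by
    ext1 v
    simp only [LinearMap.comp_apply, Submodule.subtype_apply, ContinuousLinearMap.coe_coe,
      LinearMap.sub_apply, InnerProductSpace.rankOne_apply]
    have : ((tangentPlane f x).orthogonalProjectionOnto v : R3) = v - ⟪n, v⟫ • n := by
      have h1 := (tangentPlane f x).starProjection_add_starProjection_orthogonal v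
      have h2 : (tangentPlane f x)ᗮ = ℝ ∙ n := by
        rw [tangentPlane, Submodule.orthogonal_orthogonal, hspan]
      simp only [h2] at h1
      rw [Submodule.starProjection_unit_singleton ℝ hn1] at h1
      exact eq_sub_of_add_eq h1
    rw [this, map_sub, map_smul]
  rw [hop, map_sub, InnerProductSpace.trace_rankOne, tangentialTrace, real_inner_comm]

/-- A differentiable function that vanishes at `z` is negative along a ray on which its derivative
is negative. -/
theorem eventually_neg_along_ray {f : R3 → ℝ} {z v : R3} (hf : DifferentiableAt ℝ f z)
    (h0 : f z = 0) (hv : fderiv ℝ f z v < 0) : ∀ᶠ t in 𝓝[>] (0 : ℝ), f (z + t • v) < 0 := by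
  have h1 := hf.hasFDerivAt.hasLineDerivAt v
  have h2 := (hasDerivAt_iff_tendsto_slope.1 h1).eventually_lt_const hv
  have h3 : ∀ᶠ t in 𝓝[>] (0 : ℝ), slope (fun t : ℝ => f (z + t • v)) 0 t < 0 :=
    h2.filter_mono (nhdsWithin_mono _ fun t ht => ne_of_gt ht)
  filter_upwards [h3, self_mem_nhdsWithin] with t ht htpos
  rw [slope_def_field, zero_smul, add_zero, h0, sub_zero, sub_zero] at ht
  exact (div_neg_iff.1 ht).elim (fun h => absurd htpos h.2.not_gt) fun h => h.1

theorem eventually_pos_along_ray {f : R3 → ℝ} {z v : R3} (hf : DifferentiableAt ℝ f z)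
    (h0 : f z = 0) (hv : 0 < fderiv ℝ f z v) : ∀ᶠ t in 𝓝[>] (0 : ℝ), 0 < f (z + t • v) := by
  have := eventually_neg_along_ray (f := fun y => -f y) (v := v) hf.neg (by simp [h0])
    (by rw [fderiv_fun_neg]; simpa using hv)
  simpa using this

theorem tendsto_ray (z v : R3) : Filter.Tendsto (fun t : ℝ => z + t • v) (𝓝[>] 0) (𝓝 z) := by
  have : Continuous fun t : ℝ => z + t • v := by fun_prop
  simpa using (this.tendsto 0).mono_left (nhdsWithin_le_nhds (s := Ioi 0))

theorem fderiv_gradient_pos {f : R3 → ℝ} {z : R3} (h : gradient f z ≠ 0) :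
    0 < fderiv ℝ f z (gradient f z) := by
  rw [← inner_gradient_left, real_inner_self_eq_norm_sq]
  exact pow_pos (norm_pos_iff.2 h) 2

variable {E : Set R3} {x : R3} {f g : R3 → ℝ}

theorem IsDefiningFunctionAt.differentiableAt (hf : IsDefiningFunctionAt E x f) :
    DifferentiableAt ℝ f x :=
  hf.contDiffAt.differentiableAt (by norm_num)

/-- Near `x` the boundary of `E` is the zero set of a defining function at `x`, which is a defining
function at all these points. -/
theorem IsDefiningFunctionAt.eventually (hf : IsDefiningFunctionAt E x f) :
    ∀ᶠ z in 𝓝 x, (z ∈ frontier E ↔ f z = 0) ∧ ContDiffAt ℝ 2 f z ∧ gradient f z ≠ 0 ∧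
      (f z = 0 → IsDefiningFunctionAt E z f) := by
  have hg : ∀ᶠ z in 𝓝 x, gradient f z ≠ 0 :=
    (contDiffAt_gradient hf.contDiffAt).continuousAt.eventually_ne hf.gradient_ne_zero
  filter_upwards [hg, hf.contDiffAt.eventually (by simp), hf.mem_of_neg.eventually_nhds,
    hf.notMem_of_pos.eventually_nhds] with z hz hC hneg hpos
  have hd : DifferentiableAt ℝ f z := hC.differentiableAt (by norm_num)
  refine ⟨⟨fun hzE => ?_, fun h0 => ?_⟩, hC, hz, fun h0 => ⟨hC, h0, hz, hneg, hpos⟩⟩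
  · rcases lt_trichotomy (f z) 0 with h | h | h
    · have : ∀ᶠ y in 𝓝 z, y ∈ E := by
        filter_upwards [hneg, hd.continuousAt.eventually_lt_const h] with y h1 h2 using h1 h2
      exact absurd (mem_interior_iff_mem_nhds.2 this) hzE.2
    · exact h
    · have : ∀ᶠ y in 𝓝 z, y ∉ E := by
        filter_upwards [hpos, hd.continuousAt.eventually_const_lt h] with y h1 h2 using h1 h2
      obtain ⟨y, h1, h2⟩ := (mem_closure_iff_frequently.1 hzE.1).and_eventually this |>.exists
      exact absurd h1 h2
  · have hgr := fderiv_gradient_pos hz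
    rw [frontier_eq_closure_inter_closure]
    constructor
    · refine mem_closure_of_tendsto (tendsto_ray z (-gradient f z)) ?_
      filter_upwards [eventually_neg_along_ray hd h0 (v := -gradient f z) (by simpa using hgr),
        (tendsto_ray z (-gradient f z)).eventually hneg] with t h1 h2 using h2 h1
    · refine mem_closure_of_tendsto (tendsto_ray z (gradient f z)) ?_
      filter_upwards [eventually_pos_along_ray hd h0 hgr,
        (tendsto_ray z (gradient f z)).eventually hpos] with t h1 h2 using h2 h1

/-- The outer normal does not depend on the defining function: directions that decrease `f` lead
into `E`, and so cannot increase `g`. -/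
theorem IsDefiningFunctionAt.unitNormal_eq (hf : IsDefiningFunctionAt E x f)
    (hg : IsDefiningFunctionAt E x g) : unitNormal f x = unitNormal g x := by
  have key : ∀ v, fderiv ℝ f x v < 0 → fderiv ℝ g x v ≤ 0 := by
    intro v hv
    by_contra! h
    obtain ⟨t, ⟨h1, h2⟩, h3, h4⟩ := (((eventually_neg_along_ray hf.differentiableAt hf.eq_zero hv).and
      (eventually_pos_along_ray hg.differentiableAt hg.eq_zero h)).and
      (((tendsto_ray x v).eventually hf.mem_of_neg).and
      ((tendsto_ray x v).eventually hg.notMem_of_pos))).exists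
    exact h4 h2 (h3 h1)
  set a := unitNormal f x
  set b := unitNormal g x
  have ha : ‖a‖ = 1 := norm_unitNormal hf.gradient_ne_zero
  have hb : ‖b‖ = 1 := norm_unitNormal hg.gradient_ne_zero
  have hga : 0 < ‖gradient f x‖⁻¹ := inv_pos.2 (norm_pos_iff.2 hf.gradient_ne_zero)
  have hgb : 0 < ‖gradient g x‖⁻¹ := inv_pos.2 (norm_pos_iff.2 hg.gradient_ne_zero)
  have key' : ∀ v, ⟪v, a⟫ < 0 → ⟪v, b⟫ ≤ 0 := by
    intro v hv
    rw [inner_unitNormal] at hv ⊢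
    exact mul_nonpos_of_nonneg_of_nonpos hgb.le (key v (by
      by_contra! h; exact absurd hv (mul_nonneg hga.le h).not_gt))
  have haa : ⟪a, a⟫ = 1 := by rw [real_inner_self_eq_norm_sq, ha]; norm_num
  have hbb : ⟪b, b⟫ = 1 := by rw [real_inner_self_eq_norm_sq, hb]; norm_num
  have h1 : 0 ≤ ⟪a, b⟫ := by
    have := key' (-a) (by rw [inner_neg_left, haa]; norm_num)
    rw [inner_neg_left] at this; linarith
  have hba : ⟪b, a⟫ = ⟪a, b⟫ := real_inner_comm _ _
  -- Test with `b - ⟪a, b⟫ a`, which is orthogonal to `a`, tilted slightly against `a`.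
  have h2 : 1 ≤ ⟪a, b⟫ ^ 2 := by
    by_contra! h
    have h3 := key' (b - (⟪a, b⟫ + (1 - ⟪a, b⟫ ^ 2) / 2) • a) (by
      rw [inner_sub_left, inner_smul_left, haa, hba, conj_trivial]; linarith)
    rw [inner_sub_left, inner_smul_left, hbb] at h3
    simp only [conj_trivial] at h3
    nlinarith
  have h4 : 1 ≤ ⟪a, b⟫ := by nlinarith
  have h5 : ⟪a, b⟫ = 1 := le_antisymm (by simpa [ha, hb] using real_inner_le_norm a b) h4
  exact (inner_eq_one_iff_of_norm_eq_one ha hb).1 h5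

theorem IsDefiningFunctionAt.mem_frontier (hf : IsDefiningFunctionAt E x f) : x ∈ frontier E :=
  hf.eventually.self_of_nhds.1.2 hf.eq_zero

/-- Local `C²` parametrization of the boundary of `E`. The parameter is the orthogonal projection
`P` to the tangent plane at `x`, so that `P` inverts the parametrization. -/
theorem IsDefiningFunctionAt.exists_chart (hf : IsDefiningFunctionAt E x f) {N : Set R3}
    (hN : N ∈ 𝓝 x) : ∃ (Φ : R2 → R3) (P : R3 →L[ℝ] R2) (O : Set R2) (V : Set R3),
      IsOpen O ∧ IsOpen V ∧ x ∈ V ∧ V ⊆ N ∧ Φ '' O = frontier E ∩ V ∧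
      (∀ q ∈ O, P (Φ q) = q) ∧ ∀ q ∈ O, ContDiffAt ℝ 2 Φ q := by
  have hdim : Module.finrank ℝ (tangentPlane f x) = 2 := by
    have : Fact (Module.finrank ℝ R3 = 2 + 1) := ⟨by simp⟩
    exact Submodule.finrank_orthogonal_span_singleton hf.gradient_ne_zero
  let ι : tangentPlane f x ≃ₗᵢ[ℝ] R2 :=
    (stdOrthonormalBasis ℝ (tangentPlane f x)).repr.trans
      (LinearIsometryEquiv.piLpCongrLeft 2 ℝ ℝ (finCongr hdim))
  let P : R3 →L[ℝ] R2 :=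
    ι.toContinuousLinearEquiv.toContinuousLinearMap ∘L (tangentPlane f x).orthogonalProjectionOnto
  have hPker : ∀ v, P v = 0 → v ∈ (tangentPlane f x)ᗮ := by
    intro v hv
    have h1 : (tangentPlane f x).orthogonalProjectionOnto v = 0 := by
      have h2 : ι ((tangentPlane f x).orthogonalProjectionOnto v) = 0 := hv
      simpa using h2
    exact Submodule.orthogonalProjectionOnto_eq_zero_iff.1 h1
  let Ψ : R3 → R2 × ℝ := fun y => (P y, f y)
  have hΨC : ∀ y, ContDiffAt ℝ 2 f y → ContDiffAt ℝ 2 Ψ y := fun y hy =>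
    P.contDiff.contDiffAt.prodMk hy
  let L : R3 →L[ℝ] R2 × ℝ := P.prod (fderiv ℝ f x)
  have hLinj : Function.Injective L := by
    rw [injective_iff_map_eq_zero]
    intro v hv
    have h1 : P v = 0 := congrArg Prod.fst hv
    have h2 : fderiv ℝ f x v = 0 := congrArg Prod.snd hv
    have h3 : v ∈ tangentPlane f x := by
      rw [tangentPlane, Submodule.mem_orthogonal_singleton_iff_inner_right, inner_gradient_left, h2]
    exact Submodule.disjoint_def.1 (tangentPlane f x).orthogonal_disjoint v h3 (hPker v h1)
  let Le : R3 ≃L[ℝ] R2 × ℝ :=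
    (LinearEquiv.ofInjectiveOfFinrankEq L.toLinearMap hLinj (by simp)).toContinuousLinearEquiv
  have hLe : (Le : R3 →L[ℝ] R2 × ℝ) = L := by ext v <;> rfl
  have hder : HasFDerivAt Ψ (Le : R3 →L[ℝ] R2 × ℝ) x := by
    rw [hLe]
    exact P.hasFDerivAt.prodMk hf.differentiableAt.hasFDerivAt
  have hΨx := hΨC x hf.contDiffAt
  let e := hΨx.toOpenPartialHomeomorph Ψ hder (by norm_num)
  have hxs : x ∈ e.source := hΨx.mem_toOpenPartialHomeomorph_source hder (by norm_num)
  have hsymm : ContDiffAt ℝ 2 e.symm (Ψ x) := hΨx.to_localInverse hder (by norm_num)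
  have hesx : e.symm (Ψ x) = x := e.left_inv hxs
  have hT : e.target ∩ {y | ContDiffAt ℝ 2 e.symm y ∧ e.symm y ∈ N ∧
      (e.symm y ∈ frontier E ↔ f (e.symm y) = 0)} ∈ 𝓝 (Ψ x) := by
    refine Filter.inter_mem (e.open_target.mem_nhds (e.map_source hxs)) ?_
    have hc : Filter.Tendsto e.symm (𝓝 (Ψ x)) (𝓝 x) := by
      have := hsymm.continuousAt.tendsto
      rwa [hesx] at this
    exact (hsymm.eventually (by simp)).and ((hc.eventually hN).and
      (hc.eventually (hf.eventually.mono fun z hz => hz.1)))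
  obtain ⟨T, hTsub, hTo, hxT⟩ := mem_nhds_iff.1 hT
  refine ⟨fun q => e.symm (q, 0), P, {q | (q, (0 : ℝ)) ∈ T}, e.source ∩ e ⁻¹' T, ?_,
    e.isOpen_inter_preimage hTo, ⟨hxs, hxT⟩, ?_, ?_, ?_, ?_⟩
  · exact hTo.preimage (by fun_prop)
  · rintro z ⟨hz, hzT⟩
    have h2 := (hTsub hzT).2.2.1
    rwa [e.left_inv hz] at h2
  · ext z
    constructor
    · rintro ⟨q, hq, rfl⟩
      have h := hTsub hq
      have hr : Ψ (e.symm (q, 0)) = (q, 0) := e.right_inv h.1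
      refine ⟨h.2.2.2.2 (congrArg Prod.snd hr), e.map_target h.1, ?_⟩
      rw [mem_preimage, e.right_inv h.1]
      exact hq
    · rintro ⟨hzE, hz, hzT⟩
      have h := (hTsub hzT).2.2.2
      rw [e.left_inv hz] at h
      have hr : e z = (P z, 0) := Prod.ext rfl (h.1 hzE)
      refine ⟨P z, ?_, ?_⟩
      · change (P z, (0 : ℝ)) ∈ T
        rw [← hr]; exact hzT
      · change e.symm (P z, 0) = z
        rw [← hr, e.left_inv hz]
  · intro q hq
    have hr : Ψ (e.symm (q, 0)) = (q, 0) := e.right_inv (hTsub hq).1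
    exact congrArg Prod.fst hr
  · intro q hq
    exact (hTsub hq).2.1.comp q (contDiffAt_id.prodMk contDiffAt_const)

theorem injective_fderiv_of_leftInverse {Φ : R2 → R3} {P : R3 →L[ℝ] R2} {q : R2}
    (hΦ : DifferentiableAt ℝ Φ q) (hP : ∀ᶠ p in 𝓝 q, P (Φ p) = p) :
    Function.Injective (fderiv ℝ Φ q) := by
  have h1 : HasFDerivAt (fun p => P (Φ p)) (P ∘L fderiv ℝ Φ q) q :=
    P.hasFDerivAt.comp q hΦ.hasFDerivAt
  have h2 : HasFDerivAt (fun p => P (Φ p)) (ContinuousLinearMap.id ℝ R2) q :=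
    (hasFDerivAt_id q).congr_of_eventuallyEq hP
  have h3 := h1.unique h2
  exact Function.LeftInverse.injective (g := P) fun v => by
    simpa using congrArg (fun A : R2 →L[ℝ] R2 => A v) h3

theorem inner_fderiv_unitNormal_of_levelSet {Φ : R2 → R3} {q : R2}
    (hΦ : DifferentiableAt ℝ Φ q) (hf : DifferentiableAt ℝ f (Φ q))
    (h0 : ∀ᶠ p in 𝓝 q, f (Φ p) = 0) (v : R2) : ⟪fderiv ℝ Φ q v, unitNormal f (Φ q)⟫ = 0 := by
  have h1 : HasFDerivAt (fun p => f (Φ p)) (fderiv ℝ f (Φ q) ∘L fderiv ℝ Φ q) q :=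
    hf.hasFDerivAt.comp q hΦ.hasFDerivAt
  have h2 : HasFDerivAt (fun p => f (Φ p)) (0 : R2 →L[ℝ] ℝ) q :=
    (hasFDerivAt_const (0 : ℝ) q).congr_of_eventuallyEq h0
  have h3 := congrArg (fun A : R2 →L[ℝ] ℝ => A v) (h1.unique h2)
  simp only [ContinuousLinearMap.comp_apply, zero_apply] at h3
  rw [inner_unitNormal, h3, mul_zero]

theorem inner_fderiv_unitNormal_self (hf : ContDiffAt ℝ 2 f x) (h0 : gradient f x ≠ 0) (v : R3) :
    ⟪fderiv ℝ (unitNormal f) x v, unitNormal f x⟫ = 0 := by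
  have hd : HasFDerivAt (unitNormal f) (fderiv ℝ (unitNormal f) x) x :=
    ((contDiffAt_unitNormal hf h0).differentiableAt (by norm_num)).hasFDerivAt
  have h1 := hd.inner ℝ hd
  have h2 : HasFDerivAt (fun y => ⟪unitNormal f y, unitNormal f y⟫) (0 : R3 →L[ℝ] ℝ) x := by
    refine (hasFDerivAt_const (1 : ℝ) x).congr_of_eventuallyEq ?_
    filter_upwards [(contDiffAt_gradient hf).continuousAt.eventually_ne h0] with y hy
    rw [real_inner_self_eq_norm_sq, norm_unitNormal hy]; norm_num
  have h3 := congrArg (fun A : R3 →L[ℝ] ℝ => A v) (h1.unique h2)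
  simpa [fderivInnerCLM_apply, real_inner_comm] using h3

open Classical in
/-- The outer unit normal of `E` at a boundary point, computed from a defining function. -/
noncomputable def outerNormal (E : Set R3) (x : R3) : R3 :=
  if h : ∃ f : R3 → ℝ, IsDefiningFunctionAt E x f then unitNormal h.choose x else 0

theorem IsDefiningFunctionAt.outerNormal_eq (hf : IsDefiningFunctionAt E x f) :
    outerNormal E x = unitNormal f x := by
  have h : ∃ f : R3 → ℝ, IsDefiningFunctionAt E x f := ⟨f, hf⟩
  rw [outerNormal, dif_pos h]
  exact h.choose_spec.unitNormal_eq hf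

/-- The mean curvature does not depend on the defining function, as the two unit normals agree along
the boundary of `E` and only tangential derivatives enter. -/
theorem IsDefiningFunctionAt.tangentialTrace_eq (hf : IsDefiningFunctionAt E x f)
    (hg : IsDefiningFunctionAt E x g) :
    tangentialTrace (fderiv ℝ (unitNormal f) x) (unitNormal f x) =
      tangentialTrace (fderiv ℝ (unitNormal g) x) (unitNormal g x) := by
  obtain ⟨Φ, P, O, V, hO, -, hxV, hVN, himg, hP, hΦ⟩ :=
    hf.exists_chart (Filter.inter_mem hf.eventually hg.eventually)
  obtain ⟨q, hq, rfl⟩ : x ∈ Φ '' O := by rw [himg]; exact ⟨hf.mem_frontier, hxV⟩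
  have hOq := hO.mem_nhds hq
  have hΦd : DifferentiableAt ℝ Φ q := (hΦ q hq).differentiableAt (by norm_num)
  have hmem : ∀ p ∈ O, Φ p ∈ frontier E ∩ V := fun p hp => himg ▸ mem_image_of_mem Φ hp
  have hinj := injective_fderiv_of_leftInverse hΦd (Filter.mem_of_superset hOq hP)
  have htan := inner_fderiv_unitNormal_of_levelSet (f := f) hΦd hf.differentiableAt
    (Filter.mem_of_superset hOq fun p hp => (hVN (hmem p hp).2).1.1.1 (hmem p hp).1)
  have heq : ∀ᶠ p in 𝓝 q, unitNormal f (Φ p) = unitNormal g (Φ p) := by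
    filter_upwards [hOq] with p hp
    have h := hmem p hp
    have hN := hVN h.2
    exact (hN.1.2.2.2 (hN.1.1.1 h.1)).unitNormal_eq (hN.2.2.2.2 (hN.2.1.1 h.1))
  have hfd := ((contDiffAt_unitNormal hf.contDiffAt hf.gradient_ne_zero).differentiableAt
    (by norm_num)).hasFDerivAt.comp q hΦd.hasFDerivAt
  have hgd := ((contDiffAt_unitNormal hg.contDiffAt hg.gradient_ne_zero).differentiableAt
    (by norm_num)).hasFDerivAt.comp q hΦd.hasFDerivAt
  have hD := hfd.unique (hgd.congr_of_eventuallyEq heq)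
  have hDv : ∀ v, fderiv ℝ (unitNormal f) (Φ q) (fderiv ℝ Φ q v) =
      fderiv ℝ (unitNormal g) (Φ q) (fderiv ℝ Φ q v) := fun v => by
    simpa using congrArg (fun A : R2 →L[ℝ] R3 => A v) hD
  have hn := norm_unitNormal hf.gradient_ne_zero
  have hne := tripleProduct_ne_zero hn htan hinj
  rw [← heq.self_of_nhds]
  apply mul_right_cancel₀ hne
  rw [tangentialTrace_mul_tripleProduct _ hn (htan _) (htan _),
    tangentialTrace_mul_tripleProduct _ hn (htan _) (htan _), hDv, hDv]

theorem IsDefiningFunctionAt.meanCurvature_eq (hf : IsDefiningFunctionAt E x f) :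
    meanCurvature E x = tangentialTrace (fderiv ℝ (unitNormal f) x) (unitNormal f x) := by
  have h : ∃ f : R3 → ℝ, IsDefiningFunctionAt E x f := ⟨f, hf⟩
  rw [meanCurvature, dif_pos h, trace_weingartenMap h.choose_spec.gradient_ne_zero]
  exact h.choose_spec.tangentialTrace_eq hf

theorem continuous_tangentialTrace :
    Continuous fun p : (R3 →L[ℝ] R3) × R3 => tangentialTrace p.1 p.2 := by
  have : (fun p : (R3 →L[ℝ] R3) × R3 => tangentialTrace p.1 p.2) = fun p =>
      (p.1 (EuclideanSpace.single 0 1) 0 + p.1 (EuclideanSpace.single 1 1) 1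
      + p.1 (EuclideanSpace.single 2 1) 2) - ⟪p.1 p.2, p.2⟫ := by
    funext p; rw [tangentialTrace, trace_eq_coord]
  rw [this]
  fun_prop

theorem IsC2Regular.continuousOn_outerNormal (hE : IsC2Regular E) :
    ContinuousOn (outerNormal E) (frontier E) := by
  intro x hx
  obtain ⟨f, hf⟩ := hE x hx
  have h1 : ContinuousWithinAt (unitNormal f) (frontier E) x :=
    (contDiffAt_unitNormal hf.contDiffAt hf.gradient_ne_zero).continuousAt.continuousWithinAt
  refine h1.congr_of_eventuallyEq ?_ hf.outerNormal_eq
  filter_upwards [mem_nhdsWithin_of_mem_nhds hf.eventually, self_mem_nhdsWithin] with z hz hzE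
  exact (hz.2.2.2 (hz.1.1 hzE)).outerNormal_eq

theorem IsC2Regular.continuousOn_meanCurvature (hE : IsC2Regular E) :
    ContinuousOn (meanCurvature E) (frontier E) := by
  intro x hx
  obtain ⟨f, hf⟩ := hE x hx
  have h0 := contDiffAt_unitNormal hf.contDiffAt hf.gradient_ne_zero
  have h1 : ContinuousAt (fun z => tangentialTrace (fderiv ℝ (unitNormal f) z) (unitNormal f z)) x :=
    continuous_tangentialTrace.continuousAt.comp (f := fun z => (fderiv ℝ (unitNormal f) z,
      unitNormal f z)) ((h0.continuousAt_fderiv (by norm_num)).prodMk h0.continuousAt)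
  refine h1.continuousWithinAt.congr_of_eventuallyEq ?_ hf.meanCurvature_eq
  filter_upwards [mem_nhdsWithin_of_mem_nhds hf.eventually, self_mem_nhdsWithin] with z hz hzE
  exact (hz.2.2.2 (hz.1.1 hzE)).meanCurvature_eq

theorem IsC2Regular.norm_outerNormal (hE : IsC2Regular E) (hx : x ∈ frontier E) :
    ‖outerNormal E x‖ = 1 := by
  obtain ⟨f, hf⟩ := hE x hx
  rw [hf.outerNormal_eq, norm_unitNormal hf.gradient_ne_zero]

/-! ### Integration in charts -/

/-- `Φ : O → frontier E ∩ V` is a `C²` chart of the boundary of `E` with inverse the linear map `P`,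
at all of whose points `f` is a defining function of `E`. -/
structure IsChart (E : Set R3) (f : R3 → ℝ) (Φ : R2 → R3) (P : R3 →L[ℝ] R2) (O : Set R2)
    (V : Set R3) : Prop where
  isOpen_domain : IsOpen O
  isOpen_range : IsOpen V
  image_eq : Φ '' O = frontier E ∩ V
  left_inv : ∀ q ∈ O, P (Φ q) = q
  contDiffAt : ∀ q ∈ O, ContDiffAt ℝ 2 Φ q
  isDefining : ∀ q ∈ O, IsDefiningFunctionAt E (Φ q) f

theorem IsDefiningFunctionAt.exists_isChart (hf : IsDefiningFunctionAt E x f) :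
    ∃ Φ P O V, IsChart E f Φ P O V ∧ x ∈ V := by
  obtain ⟨Φ, P, O, V, hO, hV, hxV, hVN, himg, hP, hΦ⟩ := hf.exists_chart hf.eventually
  refine ⟨Φ, P, O, V, ⟨hO, hV, himg, hP, hΦ, fun q hq => ?_⟩, hxV⟩
  have hm : Φ q ∈ frontier E ∩ V := himg ▸ mem_image_of_mem Φ hq
  have hN := hVN hm.2
  exact hN.2.2.2 (hN.1.1 hm.1)

namespace IsChart

variable {Φ : R2 → R3} {P : R3 →L[ℝ] R2} {O : Set R2} {V : Set R3}

theorem mem (h : IsChart E f Φ P O V) {q : R2} (hq : q ∈ O) : Φ q ∈ frontier E ∩ V :=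
  h.image_eq ▸ mem_image_of_mem Φ hq

theorem right_inv (h : IsChart E f Φ P O V) {z : R3} (hz : z ∈ frontier E ∩ V) :
    P z ∈ O ∧ Φ (P z) = z := by
  rw [← h.image_eq] at hz
  obtain ⟨q, hq, rfl⟩ := hz
  rw [h.left_inv q hq]
  exact ⟨hq, rfl⟩

theorem restrict (h : IsChart E f Φ P O V) {O' : Set R2} (hO' : IsOpen O') (hsub : O' ⊆ O) :
    IsChart E f Φ P O' (V ∩ P ⁻¹' O') where
  isOpen_domain := hO'
  isOpen_range := h.isOpen_range.inter (hO'.preimage P.continuous)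
  image_eq := by
    ext z
    constructor
    · rintro ⟨q, hq, rfl⟩
      have := h.mem (hsub hq)
      exact ⟨this.1, this.2, by rwa [mem_preimage, h.left_inv q (hsub hq)]⟩
    · rintro ⟨h1, h2, h3⟩
      exact ⟨P z, h3, (h.right_inv ⟨h1, h2⟩).2⟩
  left_inv q hq := h.left_inv q (hsub hq)
  contDiffAt q hq := h.contDiffAt q (hsub hq)
  isDefining q hq := h.isDefining q (hsub hq)

theorem differentiableAt (h : IsChart E f Φ P O V) {q : R2} (hq : q ∈ O) :
    DifferentiableAt ℝ Φ q := (h.contDiffAt q hq).differentiableAt (by norm_num)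

theorem continuousOn (h : IsChart E f Φ P O V) : ContinuousOn Φ O := fun q hq =>
  (h.contDiffAt q hq).continuousAt.continuousWithinAt

theorem contDiffAt_fderiv (h : IsChart E f Φ P O V) {q : R2} (hq : q ∈ O) :
    ContDiffAt ℝ 1 (fderiv ℝ Φ) q := (h.contDiffAt q hq).fderiv_right (by norm_num)

theorem continuousOn_fderiv (h : IsChart E f Φ P O V) : ContinuousOn (fderiv ℝ Φ) O := fun _ hq =>
  (h.contDiffAt_fderiv hq).continuousAt.continuousWithinAt

theorem injective_fderiv (h : IsChart E f Φ P O V) {q : R2} (hq : q ∈ O) :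
    Function.Injective (fderiv ℝ Φ q) :=
  injective_fderiv_of_leftInverse (h.differentiableAt hq)
    (Filter.mem_of_superset (h.isOpen_domain.mem_nhds hq) h.left_inv)

theorem inner_fderiv_unitNormal (h : IsChart E f Φ P O V) {q : R2} (hq : q ∈ O) (v : R2) :
    ⟪fderiv ℝ Φ q v, unitNormal f (Φ q)⟫ = 0 :=
  inner_fderiv_unitNormal_of_levelSet (h.differentiableAt hq) (h.isDefining q hq).differentiableAt
    (Filter.mem_of_superset (h.isOpen_domain.mem_nhds hq) fun p hp => (h.isDefining p hp).eq_zero) v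

theorem contDiffAt_unitNormal (h : IsChart E f Φ P O V) {q : R2} (hq : q ∈ O) :
    ContDiffAt ℝ 1 (unitNormal f) (Φ q) :=
  C2Set.contDiffAt_unitNormal (h.isDefining q hq).contDiffAt (h.isDefining q hq).gradient_ne_zero

theorem map_restrict (h : IsChart E f Φ P O V) :
    (μHE[2].restrict (frontier E ∩ V)).map P =
      (volume.restrict O).withDensity
        fun q => ENNReal.ofReal (fderiv ℝ Φ q).toLinearMap.normDet := by
  have := map_restrict_euclideanHausdorffMeasure_image h.isOpen_domain P.continuous.measurable
    h.left_inv (fun q hq => (h.contDiffAt q hq).hasStrictFDerivAt (by norm_num))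
    (fun q hq => h.injective_fderiv hq) h.continuousOn_fderiv
  rwa [finrank_euclideanSpace_fin, h.image_eq] at this

theorem measurableSet (h : IsChart E f Φ P O V) : MeasurableSet (frontier E ∩ V) :=
  isClosed_frontier.measurableSet.inter h.isOpen_range.measurableSet

theorem continuousOn_normDet (h : IsChart E f Φ P O V) :
    ContinuousOn (fun q => (fderiv ℝ Φ q).toLinearMap.normDet) O :=
  ContinuousLinearMap.continuous_normDet.comp_continuousOn h.continuousOn_fderiv

theorem euclideanHausdorffMeasure_eq (h : IsChart E f Φ P O V) :
    μHE[2] (frontier E ∩ V) = ∫⁻ q in O, ENNReal.ofReal (fderiv ℝ Φ q).toLinearMap.normDet := by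
  have := congrArg (fun ν : Measure R2 => ν univ) h.map_restrict
  simpa [Measure.map_apply P.continuous.measurable] using this

theorem setIntegral_eq (h : IsChart E f Φ P O V) {G : R3 → ℝ} (hG : ContinuousOn G (frontier E)) :
    ∫ z in frontier E ∩ V, G z ∂μHE[2] =
      ∫ q in O, (fderiv ℝ Φ q).toLinearMap.normDet * G (Φ q) := by
  have hGΦ : AEStronglyMeasurable (fun q => G (Φ q)) (volume.restrict O) :=
    (hG.comp h.continuousOn fun q hq => (h.mem hq).1).aestronglyMeasurable
      h.isOpen_domain.measurableSet
  have hJ : AEMeasurable (fun q => (fderiv ℝ Φ q).toLinearMap.normDet) (volume.restrict O) :=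
    h.continuousOn_normDet.aemeasurable h.isOpen_domain.measurableSet
  calc ∫ z in frontier E ∩ V, G z ∂μHE[2]
      = ∫ z in frontier E ∩ V, G (Φ (P z)) ∂μHE[2] :=
        setIntegral_congr_fun h.measurableSet fun z hz => by
          simp only [(h.right_inv hz).2]
    _ = ∫ q, G (Φ q) ∂((μHE[2].restrict (frontier E ∩ V)).map P) := by
        refine (integral_map (φ := P) (f := fun q => G (Φ q)) P.continuous.measurable.aemeasurable ?_).symm
        rw [h.map_restrict]
        exact hGΦ.mono_ac (withDensity_absolutelyContinuous _ _)
    _ = ∫ q in O, (fderiv ℝ Φ q).toLinearMap.normDet * G (Φ q) := by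
        rw [h.map_restrict, integral_withDensity_eq_integral_toReal_smul₀ hJ.ennreal_ofReal
          (by simp)]
        refine integral_congr_ae (ae_of_all _ fun q => ?_)
        simp only [smul_eq_mul]
        rw [ENNReal.toReal_ofReal (LinearMap.normDet_nonneg _)]

end IsChart

theorem contDiffAt_tripleProduct {F : Type*} [NormedAddCommGroup F] [NormedSpace ℝ F]
    {u v w : F → R3} {q : F} {n : WithTop ℕ∞} (hu : ContDiffAt ℝ n u q)
    (hv : ContDiffAt ℝ n v q) (hw : ContDiffAt ℝ n w q) :
    ContDiffAt ℝ n (fun p => tripleProduct (u p) (v p) (w p)) q := by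
  have H : ∀ {u : F → R3}, ContDiffAt ℝ n u q → ∀ i : Fin 3, ContDiffAt ℝ n (fun p => u p i) q :=
    fun hu i => (EuclideanSpace.proj i : R3 →L[ℝ] ℝ).contDiff.contDiffAt.comp q hu
  unfold tripleProduct
  exact (((H hu 0).mul (((H hv 1).mul (H hw 2)).sub ((H hv 2).mul (H hw 1)))).sub
    ((H hu 1).mul (((H hv 0).mul (H hw 2)).sub ((H hv 2).mul (H hw 0))))).add
    ((H hu 2).mul (((H hv 0).mul (H hw 1)).sub ((H hv 1).mul (H hw 0))))

theorem continuous_tripleProduct :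
    Continuous fun p : R3 × R3 × R3 => tripleProduct p.1 p.2.1 p.2.2 :=
  continuous_iff_continuousAt.2 fun _ => (contDiffAt_tripleProduct (n := 0) contDiffAt_fst
    contDiffAt_snd.fst contDiffAt_snd.snd).continuousAt

/-- Near each boundary point there is a chart whose image has finite area and on which the
orientation of the coordinate frame relative to the outer normal is a constant sign `s`. -/
theorem IsDefiningFunctionAt.exists_oriented_chart (hf : IsDefiningFunctionAt E x f) :
    ∃ Φ P O V, IsChart E f Φ P O V ∧ x ∈ V ∧ μHE[2] (frontier E ∩ V) < ∞ ∧
      ∃ s : ℝ, s ≠ 0 ∧ ∀ q ∈ O, tripleProduct (unitNormal f (Φ q))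
        (fderiv ℝ Φ q (EuclideanSpace.single 0 1)) (fderiv ℝ Φ q (EuclideanSpace.single 1 1)) =
          s * (fderiv ℝ Φ q).toLinearMap.normDet := by
  obtain ⟨Φ, P, O, V, h, hxV⟩ := hf.exists_isChart
  obtain ⟨hq, hΦq⟩ := h.right_inv ⟨hf.mem_frontier, hxV⟩
  set q₀ := P x
  set T : R2 → ℝ := fun q => tripleProduct (unitNormal f (Φ q))
        (fderiv ℝ Φ q (EuclideanSpace.single 0 1)) (fderiv ℝ Φ q (EuclideanSpace.single 1 1))
  set J : R2 → ℝ := fun q => (fderiv ℝ Φ q).toLinearMap.normDet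
  have habs : ∀ q ∈ O, |T q| = J q := fun q hq =>
    abs_tripleProduct_eq_normDet (norm_unitNormal (h.isDefining q hq).gradient_ne_zero) _
      (h.inner_fderiv_unitNormal hq)
  have hTc : ContinuousOn T O := by
    have h1 : ContinuousOn (fun q => unitNormal f (Φ q)) O := fun q hq =>
      ((h.contDiffAt_unitNormal hq).continuousAt.comp
        (h.contDiffAt q hq).continuousAt).continuousWithinAt
    exact continuous_tripleProduct.comp_continuousOn (h1.prodMk
      ((h.continuousOn_fderiv.clm_apply continuousOn_const).prodMk
        (h.continuousOn_fderiv.clm_apply continuousOn_const)))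
  have hT0 : T q₀ ≠ 0 := tripleProduct_ne_zero
    (norm_unitNormal (h.isDefining q₀ hq).gradient_ne_zero) (h.inner_fderiv_unitNormal hq)
    (h.injective_fderiv hq)
  have hOn := h.isOpen_domain.mem_nhds hq
  have hTq := hTc.continuousAt hOn
  obtain ⟨O', hO'sub, hO', hqO'⟩ := mem_nhds_iff.1 (Filter.inter_mem hOn (Filter.inter_mem
    (Metric.ball_mem_nhds q₀ one_pos) (Filter.inter_mem
    ((h.continuousOn_normDet.continuousAt hOn).eventually_lt_const (lt_add_one (J q₀)))
    ((hTq.mul continuousAt_const).eventually_const_lt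
      (show 0 < T q₀ * T q₀ from mul_self_pos.2 hT0)))))
  refine ⟨Φ, P, O', V ∩ P ⁻¹' O', h.restrict hO' fun q hq => (hO'sub hq).1, ⟨hxV, hqO'⟩, ?_,
    SignType.sign (T q₀), ?_, fun q hq => ?_⟩
  · rw [(h.restrict hO' fun q hq => (hO'sub hq).1).euclideanHausdorffMeasure_eq]
    calc ∫⁻ q in O', ENNReal.ofReal (J q) ≤ ∫⁻ q in O', ENNReal.ofReal (J q₀ + 1) :=
          setLIntegral_mono measurable_const fun q hq =>
            ENNReal.ofReal_le_ofReal (hO'sub hq).2.2.1.le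
      _ = ENNReal.ofReal (J q₀ + 1) * volume O' := setLIntegral_const _ _
      _ < ∞ := ENNReal.mul_lt_top ENNReal.ofReal_lt_top
          ((measure_mono fun q hq => (hO'sub hq).2.1).trans_lt measure_ball_lt_top)
  · rcases lt_or_gt_of_ne hT0 with h3 | h3
    · rw [sign_neg h3]; simp
    · rw [sign_pos h3]; simp
  · have h1 := (hO'sub hq).2.2.2
    have h2 := habs q (hO'sub hq).1
    change T q = _ * J q
    rw [← h2]
    rcases lt_or_gt_of_ne hT0 with h3 | h3
    · have : T q < 0 := by
        by_contra! h4
        exact absurd h1 (mul_nonpos_of_nonneg_of_nonpos h4 h3.le).not_gt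
      rw [sign_neg h3, abs_of_neg this]; simp
    · have : 0 < T q := by
        by_contra! h4
        exact absurd h1 (mul_nonpos_of_nonpos_of_nonneg h4 h3.le).not_gt
      rw [sign_pos h3, abs_of_pos this]; simp

/-! ### The first variation formula -/

theorem hasFDerivAt_tripleProduct {F : Type*} [NormedAddCommGroup F] [NormedSpace ℝ F]
    {u v w : F → R3} {u' v' w' : F →L[ℝ] R3} {q : F} (hu : HasFDerivAt u u' q)
    (hv : HasFDerivAt v v' q) (hw : HasFDerivAt w w' q) (d : F) :
    fderiv ℝ (fun p => tripleProduct (u p) (v p) (w p)) q d =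
      tripleProduct (u' d) (v q) (w q) + tripleProduct (u q) (v' d) (w q)
        + tripleProduct (u q) (v q) (w' d) := by
  have H : ∀ {u : F → R3} {u' : F →L[ℝ] R3}, HasFDerivAt u u' q → ∀ i : Fin 3,
      HasFDerivAt (fun p => u p i) ((EuclideanSpace.proj i : R3 →L[ℝ] ℝ) ∘L u') q :=
    fun hu i => (EuclideanSpace.proj i : R3 →L[ℝ] ℝ).hasFDerivAt.comp q hu
  have key := (((H hu 0).mul (((H hv 1).mul (H hw 2)).sub ((H hv 2).mul (H hw 1)))).sub
    ((H hu 1).mul (((H hv 0).mul (H hw 2)).sub ((H hv 2).mul (H hw 0))))).add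
    ((H hu 2).mul (((H hv 0).mul (H hw 1)).sub ((H hv 1).mul (H hw 0))))
  have h2 := key.fderiv
  unfold tripleProduct
  refine (congrArg (fun A : F →L[ℝ] ℝ => A d) h2).trans ?_
  simp
  ring

theorem integral_fderiv_eq_zero {F : Type*} [NormedAddCommGroup F] [NormedSpace ℝ F]
    [FiniteDimensional ℝ F] [MeasurableSpace F] [BorelSpace F] (μ : Measure F)
    [μ.IsAddHaarMeasure] {g : F → ℝ} (hg : ContDiff ℝ 1 g) (hc : HasCompactSupport g) (v : F) :
    Integrable (fun q => fderiv ℝ g q v) μ ∧ ∫ q, fderiv ℝ g q v ∂μ = 0 := by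
  have hi : Integrable (fun q => fderiv ℝ g q v) μ :=
    ((hg.continuous_fderiv (by norm_num)).clm_apply continuous_const).integrable_of_hasCompactSupport
      (hc.fderiv_apply ℝ v)
  refine ⟨hi, ?_⟩
  have := integral_mul_fderiv_eq_neg_fderiv_mul_of_integrable (μ := μ) (f := fun _ : F => (1 : ℝ))
    (g := g) (v := v) (by simp) (by simpa using hi)
    (by simpa using hg.continuous.integrable_of_hasCompactSupport hc)
    (fun _ _ => differentiableAt_const _) (fun q _ => hg.differentiable (by norm_num) q)
  simpa using this

/-- The integrand of the first variation formula: tangential divergence minus mean curvature times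
normal component. -/
noncomputable def firstVariationDensity (E : Set R3) (X : R3 → R3) (z : R3) : ℝ :=
  tangentialTrace (fderiv ℝ X z) (outerNormal E z) - meanCurvature E z * ⟪X z, outerNormal E z⟫

theorem IsC2Regular.continuousOn_firstVariationDensity (hE : IsC2Regular E) {X : R3 → R3}
    (hX : ContDiff ℝ 1 X) : ContinuousOn (firstVariationDensity E X) (frontier E) := by
  refine ContinuousOn.sub ?_ (hE.continuousOn_meanCurvature.mul
    (hX.continuous.continuousOn.inner hE.continuousOn_outerNormal))
  exact continuous_tangentialTrace.comp_continuousOn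
    ((hX.continuous_fderiv (by norm_num)).continuousOn.prodMk hE.continuousOn_outerNormal)

theorem firstVariationDensity_eq_zero {X : R3 → R3} {z : R3} (hz : z ∉ tsupport X) :
    firstVariationDensity E X z = 0 := by
  have h1 : X z = 0 := image_eq_zero_of_notMem_tsupport hz
  have h2 : fderiv ℝ X z = 0 := by
    have : z ∉ tsupport (fderiv ℝ X) := fun h => hz (tsupport_fderiv_subset ℝ h)
    exact image_eq_zero_of_notMem_tsupport this
  simp [firstVariationDensity, h1, h2, tangentialTrace]

/-- The first variation formula for vector fields supported in a chart: the integrand is the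
exterior derivative of a compactly supported one-form in the parameter plane. -/
theorem IsChart.integral_firstVariationDensity {Φ : R2 → R3} {P : R3 →L[ℝ] R2} {O : Set R2}
    {V : Set R3} (h : IsChart E f Φ P O V) {s : ℝ} (hs : s ≠ 0)
    (hT : ∀ q ∈ O, tripleProduct (unitNormal f (Φ q))
        (fderiv ℝ Φ q (EuclideanSpace.single 0 1)) (fderiv ℝ Φ q (EuclideanSpace.single 1 1)) =
          s * (fderiv ℝ Φ q).toLinearMap.normDet)
    (hE : IsC2Regular E) {X : R3 → R3} (hX : ContDiff ℝ 1 X) (hXc : HasCompactSupport X)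
    (hXV : tsupport X ⊆ V) :
    ∫ z in frontier E, firstVariationDensity E X z ∂μHE[2] = 0 := by
  classical
  set K : Set R2 := P '' (frontier E ∩ tsupport X)
  have hK : IsCompact K := (hXc.isCompact.inter_left isClosed_frontier).image P.continuous
  have hKO : K ⊆ O := by
    rintro _ ⟨z, hz, rfl⟩
    exact (h.right_inv ⟨hz.1, hXV hz.2⟩).1
  let γ : R2 → R2 → ℝ := fun e q => if q ∈ O then
    tripleProduct (X (Φ q)) (unitNormal f (Φ q)) (fderiv ℝ Φ q e) else 0
  have hγK : ∀ e, ∀ q ∉ K, γ e q = 0 := by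
    intro e q hq
    by_cases hqO : q ∈ O
    · have : X (Φ q) = 0 := by
        by_contra h0
        exact hq ⟨Φ q, ⟨(h.mem hqO).1, subset_tsupport X h0⟩, h.left_inv q hqO⟩
      simp [γ, hqO, this, tripleProduct]
    · simp [γ, hqO]
  have hγnear : ∀ e, ∀ q ∉ K, γ e =ᶠ[𝓝 q] 0 := fun e q hq =>
    Filter.mem_of_superset (hK.isClosed.isOpen_compl.mem_nhds hq) fun p hp => hγK e p hp
  have hγO : ∀ e, ∀ q ∈ O, γ e =ᶠ[𝓝 q] fun q =>
      tripleProduct (X (Φ q)) (unitNormal f (Φ q)) (fderiv ℝ Φ q e) := fun e q hq =>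
    Filter.mem_of_superset (h.isOpen_domain.mem_nhds hq) fun p hp => by
      have hp' : p ∈ O := hp
      simp [γ, hp']
  have hXΦ : ∀ q ∈ O, ContDiffAt ℝ 1 (fun q => X (Φ q)) q := fun q hq =>
    hX.contDiffAt.comp q ((h.contDiffAt q hq).of_le (by norm_num))
  have hnΦ : ∀ q ∈ O, ContDiffAt ℝ 1 (fun q => unitNormal f (Φ q)) q := fun q hq =>
    (h.contDiffAt_unitNormal hq).comp q ((h.contDiffAt q hq).of_le (by norm_num))
  have hγC : ∀ e, ContDiff ℝ 1 (γ e) := by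
    intro e
    rw [contDiff_iff_contDiffAt]
    intro q
    by_cases hq : q ∈ K
    · have hqO := hKO hq
      exact (contDiffAt_tripleProduct (hXΦ q hqO) (hnΦ q hqO)
        ((h.contDiffAt_fderiv hqO).clm_apply contDiffAt_const)).congr_of_eventuallyEq (hγO e q hqO)
    · exact (contDiffAt_const (c := (0 : ℝ))).congr_of_eventuallyEq (hγnear e q hq)
  have hγc : ∀ e, HasCompactSupport (γ e) := fun e => HasCompactSupport.intro hK (hγK e)
  set e₀ : R2 := EuclideanSpace.single 0 1
  set e₁ : R2 := EuclideanSpace.single 1 1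
  obtain ⟨hi1, h1⟩ := integral_fderiv_eq_zero volume (hγC e₁) (hγc e₁) e₀
  obtain ⟨hi0, h0⟩ := integral_fderiv_eq_zero volume (hγC e₀) (hγc e₀) e₁
  have hmain : ∫ q, (fderiv ℝ (γ e₁) q e₀ - fderiv ℝ (γ e₀) q e₁) = 0 := by
    rw [integral_sub hi1 hi0, h1, h0, sub_zero]
  have hpt : ∀ q ∈ O, fderiv ℝ (γ e₁) q e₀ - fderiv ℝ (γ e₀) q e₁ =
      -s * ((fderiv ℝ Φ q).toLinearMap.normDet * firstVariationDensity E X (Φ q)) := by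
    intro q hq
    have hd := h.isDefining q hq
    have hΦd := (h.differentiableAt hq).hasFDerivAt
    have hXd := ((hX.differentiable (by norm_num)) (Φ q)).hasFDerivAt.comp q hΦd
    have hnd := ((h.contDiffAt_unitNormal hq).differentiableAt
      (by norm_num)).hasFDerivAt.comp q hΦd
    have hDΦ := ((h.contDiffAt_fderiv hq).differentiableAt (by norm_num)).hasFDerivAt
    have hD : ∀ e d, fderiv ℝ (γ e) q d = _ := fun e d =>
      (congrArg (fun A : R2 →L[ℝ] ℝ => A d) (hγO e q hq).fderiv_eq).trans
        (hasFDerivAt_tripleProduct hXd hnd (hDΦ.clm_apply (hasFDerivAt_const e q)) d)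
    rw [hD, hD]
    have hsym : fderiv ℝ (fderiv ℝ Φ) q e₀ e₁ = fderiv ℝ (fderiv ℝ Φ) q e₁ e₀ :=
      ((h.contDiffAt q hq).isSymmSndFDerivAt (by simp)) e₀ e₁
    have hid := tripleProduct_exterior_derivative (fderiv ℝ X (Φ q))
      (fderiv ℝ (unitNormal f) (Φ q)) (X (Φ q)) (norm_unitNormal hd.gradient_ne_zero)
      (h.inner_fderiv_unitNormal hq e₀) (h.inner_fderiv_unitNormal hq e₁)
      (inner_fderiv_unitNormal_self hd.contDiffAt hd.gradient_ne_zero _)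
      (inner_fderiv_unitNormal_self hd.contDiffAt hd.gradient_ne_zero _)
    rw [hT q hq, ← hd.meanCurvature_eq, ← hd.outerNormal_eq] at hid
    simp only [ContinuousLinearMap.comp_apply, add_apply,
      ContinuousLinearMap.flip_apply, zero_apply, map_zero, zero_add, hsym, Function.comp_apply,
      ← hd.outerNormal_eq] at hid ⊢
    rw [firstVariationDensity]
    linear_combination hid
  have hO0 : ∀ q ∉ O, fderiv ℝ (γ e₁) q e₀ - fderiv ℝ (γ e₀) q e₁ = 0 := by
    intro q hq
    have hqK : q ∉ K := fun hk => hq (hKO hk)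
    rw [(hγnear e₁ q hqK).fderiv_eq, (hγnear e₀ q hqK).fderiv_eq]
    simp
  rw [← setIntegral_eq_integral_of_forall_compl_eq_zero hO0,
    setIntegral_congr_fun h.isOpen_domain.measurableSet hpt, integral_const_mul,
    ← h.setIntegral_eq (hE.continuousOn_firstVariationDensity hX)] at hmain
  have hz := (mul_eq_zero.1 hmain).resolve_left (neg_ne_zero.2 hs)
  rw [← hz]
  refine setIntegral_eq_of_subset_of_forall_sdiff_eq_zero isClosed_frontier.measurableSet
    inter_subset_left fun z hz => firstVariationDensity_eq_zero fun hzX => hz.2 ⟨hz.1, hXV hzX⟩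

theorem isCompact_frontier (hb : Bornology.IsBounded E) : IsCompact (frontier E) :=
  Metric.isCompact_of_isClosed_isBounded isClosed_frontier
    (hb.closure.subset frontier_subset_closure)

theorem IsC2Regular.euclideanHausdorffMeasure_frontier_lt_top (hE : IsC2Regular E)
    (hb : Bornology.IsBounded E) : μHE[2] (frontier E) < ∞ := by
  refine (isCompact_frontier hb).measure_lt_top_of_nhdsWithin fun x hx => ?_
  obtain ⟨f, hf⟩ := hE x hx
  obtain ⟨Φ, P, O, V, h, hxV, hfin, -⟩ := hf.exists_oriented_chart
  exact ⟨frontier E ∩ V, inter_mem_nhdsWithin _ (h.isOpen_range.mem_nhds hxV), hfin⟩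

theorem IsC2Regular.integrableOn (hE : IsC2Regular E) (hb : Bornology.IsBounded E) {G : R3 → ℝ}
    (hG : ContinuousOn G (frontier E)) : IntegrableOn G (frontier E) μHE[2] := by
  obtain ⟨C, hC⟩ := (isCompact_frontier hb).exists_bound_of_continuousOn hG
  exact IntegrableOn.of_bound (hE.euclideanHausdorffMeasure_frontier_lt_top hb)
    (hG.aestronglyMeasurable isClosed_frontier.measurableSet) C
    ((ae_restrict_iff' isClosed_frontier.measurableSet).2 (ae_of_all _ hC))

theorem tangentialTrace_sum {ι : Type*} (s : Finset ι) (A : ι → R3 →L[ℝ] R3) (n : R3) :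
    tangentialTrace (∑ i ∈ s, A i) n = ∑ i ∈ s, tangentialTrace (A i) n := by
  simp only [tangentialTrace, trace_eq_coord, Finset.sum_sub_distrib, Finset.sum_add_distrib,
    sum_apply, sum_inner, WithLp.ofLp_sum, Finset.sum_apply]

/-- The first variation formula: on the boundary of a bounded `C²`-regular set the tangential
divergence of a `C¹` vector field has the same integral as the mean curvature times the normal
component of the field. -/
theorem IsC2Regular.integral_firstVariationDensity (hE : IsC2Regular E)
    (hb : Bornology.IsBounded E) {X : R3 → R3} (hX : ContDiff ℝ 1 X) :
    ∫ z in frontier E, firstVariationDensity E X z ∂μHE[2] = 0 := by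
  classical
  have hloc : ∀ x ∈ frontier E, ∃ V : Set R3, IsOpen V ∧ x ∈ V ∧ ∀ Y : R3 → R3, ContDiff ℝ 1 Y →
      tsupport Y ⊆ V → ∫ z in frontier E, firstVariationDensity E Y z ∂μHE[2] = 0 := by
    intro x hx
    obtain ⟨f, hf⟩ := hE x hx
    obtain ⟨Φ, P, O, V, h, hxV, -, s, hs, hT⟩ := hf.exists_oriented_chart
    refine ⟨V ∩ Metric.ball x 1, h.isOpen_range.inter Metric.isOpen_ball,
      ⟨hxV, Metric.mem_ball_self one_pos⟩, fun Y hY hYV => ?_⟩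
    refine h.integral_firstVariationDensity hs hT hE hY ?_ (hYV.trans inter_subset_left)
    exact Metric.isCompact_of_isClosed_isBounded (isClosed_tsupport Y)
      (Metric.isBounded_ball.subset (hYV.trans inter_subset_right))
  choose! V hVo hxV hV using hloc
  obtain ⟨t, ht⟩ := (isCompact_frontier hb).elim_nhds_subcover' (fun x _ => V x)
    fun x hx => (hVo x hx).mem_nhds (hxV x hx)
  -- The complement of the boundary completes the charts to a finite cover of the whole space.
  let U : Option t → Set R3 := fun i => i.elim (frontier E)ᶜ fun x => V x.1
  have hUo : ∀ i, IsOpen (U i) := by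
    rintro (_ | x)
    · exact isClosed_frontier.isOpen_compl
    · exact hVo _ x.1.2
  have hUcov : univ ⊆ ⋃ i, U i := by
    intro z _
    by_cases hz : z ∈ frontier E
    · obtain ⟨x, hx, hzx⟩ := mem_iUnion₂.1 (ht hz)
      exact mem_iUnion.2 ⟨some ⟨x, hx⟩, hzx⟩
    · exact mem_iUnion.2 ⟨none, hz⟩
  obtain ⟨χ, hχ⟩ := SmoothPartitionOfUnity.exists_isSubordinate (modelWithCornersSelf ℝ R3) isClosed_univ U hUo hUcov
  have hχ1 : ∀ z, ∑ i, χ i z = 1 := fun z => by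
    have := χ.sum_eq_one (mem_univ z)
    rwa [finsum_eq_sum_of_fintype] at this
  have hχC : ∀ i, ContDiff ℝ 1 (χ i) := fun i => ((χ i).contMDiff.contDiff).of_le (by simp)
  have hYC : ∀ i, ContDiff ℝ 1 fun z => χ i z • X z := fun i => (hχC i).smul hX
  have hYs : ∀ i, tsupport (fun z => χ i z • X z) ⊆ U i := fun i =>
    (tsupport_smul_subset_left (χ i) X).trans (hχ i)
  have hYint : ∀ i, ∫ z in frontier E, firstVariationDensity E (fun z => χ i z • X z) z ∂μHE[2]
      = 0 := by
    rintro (_ | x)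
    · refine setIntegral_eq_zero_of_forall_eq_zero fun z hz => ?_
      exact firstVariationDensity_eq_zero fun h => hYs none h hz
    · exact hV _ x.1.2 _ (hYC _) (hYs (some x))
  have hsum : ∀ z, firstVariationDensity E X z =
      ∑ i, firstVariationDensity E (fun z => χ i z • X z) z := by
    intro z
    have hXz : X = fun z => ∑ i, χ i z • X z := by
      funext z; rw [← Finset.sum_smul, hχ1, one_smul]
    have hD : fderiv ℝ X z = ∑ i, fderiv ℝ (fun z => χ i z • X z) z := by
      conv_lhs => rw [hXz]
      exact fderiv_fun_sum fun i _ => (hYC i).differentiable (by norm_num) z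
    simp only [firstVariationDensity]
    rw [hD, tangentialTrace_sum, Finset.sum_sub_distrib, ← Finset.mul_sum, ← sum_inner,
      ← Finset.sum_smul, hχ1, one_smul]
  rw [setIntegral_congr_fun isClosed_frontier.measurableSet fun z _ => hsum z,
    integral_finsetSum _ fun i _ =>
      hE.integrableOn hb (hE.continuousOn_firstVariationDensity (hYC i))]
  exact Finset.sum_eq_zero fun i _ => hYint i

/-- The Willmore energy controls the Bochner integral of the squared mean curvature. -/
theorem IsC2Regular.integral_sq_meanCurvature_le (hE : IsC2Regular E)
    (hb : Bornology.IsBounded E) {w : ℝ} (hw : 0 ≤ w)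
    (hW : willmoreEnergy E ≤ ENNReal.ofReal w) :
    ∫ z in frontier E, meanCurvature E z ^ 2 ∂μHE[2] ≤ 4 * w := by
  have hint : IntegrableOn (fun z => meanCurvature E z ^ 2) (frontier E) μHE[2] :=
    hE.integrableOn hb (hE.continuousOn_meanCurvature.pow 2)
  have h1 := ofReal_integral_eq_lintegral_ofReal hint (ae_of_all _ fun z => sq_nonneg _)
  rw [willmoreEnergy, ← h1] at hW
  have h0 : 0 ≤ ∫ z in frontier E, meanCurvature E z ^ 2 ∂μHE[2] :=
    integral_nonneg fun z => sq_nonneg _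
  have h4 : (4⁻¹ : ℝ≥0∞) = ENNReal.ofReal 4⁻¹ := by
    rw [ENNReal.ofReal_inv_of_pos (by norm_num)]; norm_num
  rw [h4, ← ENNReal.ofReal_mul (by norm_num), ENNReal.ofReal_le_ofReal_iff hw] at hW
  linarith

/-! ### Cutoff functions of class `C¹` -/

theorem hasDerivAt_sq_max_zero (t : ℝ) : HasDerivAt (fun t : ℝ => max t 0 ^ 2) (2 * max t 0) t := by
  rcases lt_trichotomy t 0 with h | rfl | h
  · have h1 : HasDerivAt (fun _ : ℝ => (0 : ℝ)) 0 t := hasDerivAt_const _ _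
    rw [max_eq_right h.le, mul_zero]
    refine h1.congr_of_eventuallyEq ?_
    filter_upwards [Iio_mem_nhds h] with u hu
    rw [max_eq_right (le_of_lt hu)]; simp
  · rw [hasDerivAt_iff_isLittleO_nhds_zero]
    simp only [zero_add, max_self, mul_zero, smul_zero, sub_zero, ne_eq, OfNat.ofNat_ne_zero,
      not_false_eq_true, zero_pow]
    have h1 : (fun h : ℝ => max h 0 ^ 2) =O[𝓝 0] fun h => h ^ 2 :=
      Asymptotics.isBigO_of_le _ fun h => by
        rw [norm_pow, norm_pow]
        refine pow_le_pow_left₀ (norm_nonneg _) ?_ 2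
        rw [Real.norm_eq_abs, Real.norm_eq_abs, abs_of_nonneg (le_max_right _ _)]
        exact max_le (le_abs_self h) (abs_nonneg h)
    refine h1.trans_isLittleO ?_
    simpa using Asymptotics.isLittleO_pow_id (𝕜 := ℝ) (n := 2) (by norm_num)
  · rw [max_eq_left h.le]
    have h1 : HasDerivAt (fun t : ℝ => t ^ 2) (2 * t) t := by simpa using hasDerivAt_pow 2 t
    refine h1.congr_of_eventuallyEq ?_
    filter_upwards [Ioi_mem_nhds h] with u hu
    rw [max_eq_left (le_of_lt hu)]

/-- A convex `C¹` function that is constant up to `a` and equal to the identity from `b` on. -/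
theorem exists_convex_cutoff {a b : ℝ} (ha : 0 ≤ a) (hab : a < b) :
    ∃ G G' : ℝ → ℝ, (∀ s, HasDerivAt G (G' s) s) ∧ Continuous G' ∧ (∀ s, (a + b) / 2 ≤ G s) ∧
      (∀ s, s ≤ G s) ∧ (∀ s, 0 ≤ G' s) ∧ (∀ s, G' s ≤ 1) ∧ (∀ s, s * G' s ≤ G s) ∧
      (∀ s, s ≤ a → G s = (a + b) / 2 ∧ G' s = 0) ∧ ∀ s, b ≤ s → G' s = 1 := by
  have hd : 0 < b - a := sub_pos.2 hab
  obtain ⟨G, hGdef⟩ : ∃ G : ℝ → ℝ, G = fun s =>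
    (a + b) / 2 + (max (s - a) 0 ^ 2 - max (s - b) 0 ^ 2) / (2 * (b - a)) := ⟨_, rfl⟩
  obtain ⟨G', hG'def⟩ : ∃ G' : ℝ → ℝ, G' = fun s =>
    (max (s - a) 0 - max (s - b) 0) / (b - a) := ⟨_, rfl⟩
  have hA : ∀ s, s ≤ a → G s = (a + b) / 2 ∧ G' s = 0 := fun s hs => by
    simp only [hGdef, hG'def]
    rw [max_eq_right (sub_nonpos.2 hs), max_eq_right (sub_nonpos.2 (hs.trans hab.le))]
    simp
  have hB : ∀ s, b ≤ s → G s = s ∧ G' s = 1 := fun s hs => by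
    simp only [hGdef, hG'def]
    rw [max_eq_left (sub_nonneg.2 (hab.le.trans hs)), max_eq_left (sub_nonneg.2 hs)]
    constructor <;> field_simp <;> ring
  -- in between, `G` is quadratic in the affine parameter `u = G'`
  have hM : ∀ s, a ≤ s → s ≤ b → ∃ u, 0 ≤ u ∧ u ≤ 1 ∧ s = a + u * (b - a) ∧ G' s = u ∧
      G s = (a + b) / 2 + u ^ 2 * (b - a) / 2 := fun s h1 h2 => by
    refine ⟨(s - a) / (b - a), div_nonneg (sub_nonneg.2 h1) hd.le,
      (div_le_one hd).2 (by linarith), by field_simp; ring, ?_, ?_⟩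
    all_goals
      simp only [hGdef, hG'def]
      rw [max_eq_left (sub_nonneg.2 h1), max_eq_right (sub_nonpos.2 h2)]
    · simp
    · field_simp; ring
  have cases3 : ∀ {p : ℝ → ℝ → ℝ → Prop}, (∀ s, s ≤ a → p s ((a + b) / 2) 0) →
      (∀ s, b ≤ s → p s s 1) → (∀ u, 0 ≤ u → u ≤ 1 →
        p (a + u * (b - a)) ((a + b) / 2 + u ^ 2 * (b - a) / 2) u) → ∀ s, p s (G s) (G' s) := by
    intro p h1 h2 h3 s
    rcases le_total s a with h | h
    · rw [(hA s h).1, (hA s h).2]; exact h1 s h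
    · rcases le_total s b with h' | h'
      · obtain ⟨u, hu0, hu1, hs, e1, e2⟩ := hM s h h'
        rw [e1, e2, hs]; exact h3 u hu0 hu1
      · rw [(hB s h').1, (hB s h').2]; exact h2 s h'
  refine ⟨G, G', fun s => ?_, by rw [hG'def]; fun_prop, ?_, ?_, ?_, ?_, ?_, hA,
    fun s hs => (hB s hs).2⟩
  · have h1 := (hasDerivAt_sq_max_zero (s - a)).comp_sub_const s a
    have h2 := (hasDerivAt_sq_max_zero (s - b)).comp_sub_const s b
    rw [hGdef, hG'def]
    convert! ((h1.sub h2).div_const (2 * (b - a))).const_add ((a + b) / 2) using 1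
    field_simp
  · refine cases3 (p := fun _ x _ => (a + b) / 2 ≤ x) (fun s _ => le_rfl)
      (fun s hs => by linarith) fun u _ _ => le_add_of_nonneg_right (by positivity)
  · refine cases3 (p := fun s x _ => s ≤ x) (fun s _ => by linarith) (fun s _ => le_rfl)
      fun u _ _ => ?_
    nlinarith [mul_nonneg hd.le (sq_nonneg (1 - u))]
  · exact cases3 (p := fun _ _ y => 0 ≤ y) (fun _ _ => le_rfl) (fun _ _ => zero_le_one)
      fun u hu _ => hu
  · exact cases3 (p := fun _ _ y => y ≤ 1) (fun _ _ => zero_le_one) (fun _ _ => le_rfl)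
      fun u _ hu => hu
  · refine cases3 (p := fun s x y => s * y ≤ x) (fun s _ => by linarith) (fun s _ => by linarith)
      fun u hu hu1 => ?_
    nlinarith [mul_nonneg hd.le (sub_nonneg.2 (mul_le_one₀ hu1 hu hu1)),
      mul_nonneg ha (sub_nonneg.2 hu1)]

/-! ### Radial vector fields and the monotonicity estimate -/

theorem tangentialTrace_smul_id_add_rankOne (c : ℝ) (a b : R3) {n : R3} (hn : ‖n‖ = 1) :
    tangentialTrace (c • ContinuousLinearMap.id ℝ R3 + InnerProductSpace.rankOne ℝ a b) n =
      2 * c + ⟪b, a⟫ - ⟪b, n⟫ * ⟪a, n⟫ := by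
  have h1 : LinearMap.trace ℝ R3 (ContinuousLinearMap.id ℝ R3).toLinearMap = 3 := by
    change LinearMap.trace ℝ R3 LinearMap.id = 3
    rw [LinearMap.trace_id]; simp
  have hn2 : ⟪n, n⟫ = 1 := by rw [real_inner_self_eq_norm_sq, hn]; norm_num
  rw [tangentialTrace, ContinuousLinearMap.toLinearMap_add, map_add,
    InnerProductSpace.trace_rankOne, ContinuousLinearMap.toLinearMap_smul, map_smul, h1]
  simp only [add_apply, smul_apply, ContinuousLinearMap.id_apply,
    InnerProductSpace.rankOne_apply, inner_add_left, inner_smul_left, hn2, conj_trivial,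
    smul_eq_mul]
  ring

theorem hasFDerivAt_norm_sub_sq (x₀ z : R3) : HasFDerivAt (fun z : R3 => ‖z - x₀‖ ^ 2)
    ((2 : ℝ) • innerSL ℝ (z - x₀)) z := by
  have := ((hasFDerivAt_id z).sub_const x₀).norm_sq
  convert! this using 1
  ext1 v
  simp

theorem contDiff_one_of_hasDerivAt {g g' : ℝ → ℝ} (h : ∀ s, HasDerivAt g (g' s) s)
    (hc : Continuous g') : ContDiff ℝ 1 g := by
  rw [contDiff_one_iff_deriv]
  refine ⟨fun s => (h s).differentiableAt, ?_⟩
  have : deriv g = g' := by funext s; exact (h s).deriv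
  rwa [this]

/-- The first variation formula for the radial field `(z - x₀) / G (|z - x₀|²)`. -/
theorem IsC2Regular.integral_radial (hE : IsC2Regular E) (hb : Bornology.IsBounded E) (x₀ : R3)
    {G G' : ℝ → ℝ} (hG : ∀ s, HasDerivAt G (G' s) s) (hG' : Continuous G') (hpos : ∀ s, 0 < G s) :
    ∃ F : R3 → ℝ, Integrable F (μHE[2].restrict (frontier E)) ∧
      ∫ z in frontier E, F z ∂μHE[2] = 0 ∧ ∀ z ∈ frontier E, F z =
        2 * (G (‖z - x₀‖ ^ 2) - ‖z - x₀‖ ^ 2 * G' (‖z - x₀‖ ^ 2)) / G (‖z - x₀‖ ^ 2) ^ 2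
        + 2 * G' (‖z - x₀‖ ^ 2) * ⟪z - x₀, outerNormal E z⟫ ^ 2 / G (‖z - x₀‖ ^ 2) ^ 2
        - meanCurvature E z * ⟪z - x₀, outerNormal E z⟫ / G (‖z - x₀‖ ^ 2) := by
  set g : ℝ → ℝ := fun s => (G s)⁻¹
  set g' : ℝ → ℝ := fun s => -G' s / G s ^ 2
  have hGc : Continuous G := continuous_iff_continuousAt.2 fun s => (hG s).continuousAt
  have hg : ∀ s, HasDerivAt g (g' s) s := fun s => (hG s).inv (hpos s).ne'
  have hg'c : Continuous g' := hG'.neg.div (hGc.pow 2) fun s => (pow_pos (hpos s) 2).ne'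
  have hgC := contDiff_one_of_hasDerivAt hg hg'c
  set X : R3 → R3 := fun z => g (‖z - x₀‖ ^ 2) • (z - x₀)
  have hX : ContDiff ℝ 1 X := by
    have h1 : ContDiff ℝ 1 fun z : R3 => z - x₀ := contDiff_id.sub contDiff_const
    exact (hgC.comp (h1.norm_sq ℝ)).smul h1
  have hX' : ∀ z, HasFDerivAt X (g (‖z - x₀‖ ^ 2) • ContinuousLinearMap.id ℝ R3 +
      InnerProductSpace.rankOne ℝ (z - x₀) ((2 * g' (‖z - x₀‖ ^ 2)) • (z - x₀))) z := by
    intro z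
    have h1 := (hg (‖z - x₀‖ ^ 2)).comp_hasFDerivAt z (hasFDerivAt_norm_sub_sq x₀ z)
    have h2 := h1.smul ((hasFDerivAt_id z).sub_const x₀)
    convert! h2 using 1
    ext1 v
    simp only [add_apply, smul_apply, ContinuousLinearMap.id_apply,
      InnerProductSpace.rankOne_apply, inner_smul_left, conj_trivial, Function.comp_apply, id,
      ContinuousLinearMap.smulRight_apply, innerSL_apply_apply, smul_eq_mul]
    congr 2
    ring
  have hfv := hE.integral_firstVariationDensity hb hX
  refine ⟨firstVariationDensity E X, hE.integrableOn hb
    (hE.continuousOn_firstVariationDensity hX), hfv, fun z hz => ?_⟩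
  have hn := hE.norm_outerNormal hz
  rw [firstVariationDensity, (hX' z).fderiv, tangentialTrace_smul_id_add_rankOne _ _ _ hn]
  simp only [X, inner_smul_left, conj_trivial, real_inner_self_eq_norm_sq, g, g']
  have := (hpos (‖z - x₀‖ ^ 2)).ne'
  field_simp
  ring

theorem sq_inner_le_norm_sq {y n : R3} (hn : ‖n‖ = 1) : ⟪y, n⟫ ^ 2 ≤ ‖y‖ ^ 2 := by
  have := abs_real_inner_le_norm y n
  rw [hn, mul_one] at this
  rw [← sq_abs]
  exact pow_le_pow_left₀ (abs_nonneg _) this 2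

theorem measurableSet_norm_sub_sq_lt (x₀ : R3) (b : ℝ) :
    MeasurableSet {z : R3 | ‖z - x₀‖ ^ 2 < b} :=
  (isOpen_lt (by fun_prop) continuous_const).measurableSet

theorem measurableSet_norm_sub_sq_le (x₀ : R3) (b : ℝ) :
    MeasurableSet {z : R3 | ‖z - x₀‖ ^ 2 ≤ b} :=
  (isClosed_le (by fun_prop) continuous_const).measurableSet

theorem IsC2Regular.isFiniteMeasure (hE : IsC2Regular E) (hb : Bornology.IsBounded E) :
    IsFiniteMeasure ((μHE[2] : Measure R3).restrict (frontier E)) :=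
  ⟨by simpa using hE.euclideanHausdorffMeasure_frontier_lt_top hb⟩

theorem IsC2Regular.continuousOn_abs_mul_abs (hE : IsC2Regular E) (x₀ : R3) :
    ContinuousOn (fun z => |meanCurvature E z| * |⟪z - x₀, outerNormal E z⟫|) (frontier E) :=
  hE.continuousOn_meanCurvature.abs.mul
    (((continuous_id.sub continuous_const).continuousOn.inner hE.continuousOn_outerNormal).abs)

/-- The crude area bound: the area in a ball of radius `√a` is at most a constant times `a` times
the Willmore energy. -/
theorem IsC2Regular.area_le (hE : IsC2Regular E) (hb : Bornology.IsBounded E) (x₀ : R3) {a : ℝ}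
    (ha : 0 < a) :
    (μHE[2].restrict (frontier E)).real {z | ‖z - x₀‖ ^ 2 ≤ a} ≤
      3 / 4 * a * ∫ z in frontier E, meanCurvature E z ^ 2 ∂μHE[2] := by
  have := hE.isFiniteMeasure hb
  obtain ⟨G, G', hG, hG'c, hGc0, hGs, h0, h1, hsG, hGa, -⟩ :=
    exists_convex_cutoff ha.le (show a < 3 * a by linarith)
  have hc0 : (a + 3 * a) / 2 = 2 * a := by ring
  simp only [hc0] at hGc0 hGa
  have hpos : ∀ s, 0 < G s := fun s => lt_of_lt_of_le (by linarith) (hGc0 s)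
  obtain ⟨F, hFi, hF0, hF⟩ := hE.integral_radial hb x₀ hG hG'c hpos
  set S := {z : R3 | ‖z - x₀‖ ^ 2 ≤ a}
  have hS : MeasurableSet S := measurableSet_norm_sub_sq_le x₀ a
  have hH2 : Integrable (fun z => meanCurvature E z ^ 2) (μHE[2].restrict (frontier E)) :=
    hE.integrableOn hb (hE.continuousOn_meanCurvature.pow 2)
  have hSi : Integrable (S.indicator fun _ => 1 / (2 * a)) (μHE[2].restrict (frontier E)) :=
    (integrable_const _).indicator hS
  have hle : ∫ z in frontier E, (S.indicator (fun _ => 1 / (2 * a)) z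
      - 3 / 8 * meanCurvature E z ^ 2) ∂μHE[2] ≤ ∫ z in frontier E, F z ∂μHE[2] := by
    refine setIntegral_mono_on (hSi.sub (hH2.const_mul _)) hFi isClosed_frontier.measurableSet ?_
    intro z hz
    rw [hF z hz]
    have ht := sq_inner_le_norm_sq (y := z - x₀) (hE.norm_outerNormal hz)
    set s := ‖z - x₀‖ ^ 2 with hs
    set t := ⟪z - x₀, outerNormal E z⟫
    set H := meanCurvature E z
    have hp := hpos s
    -- in terms of `k = t / G`
    set k := t / G s with hk
    have e1 : 2 * G' s * t ^ 2 / G s ^ 2 = 2 * G' s * k ^ 2 := by rw [hk]; field_simp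
    have e2 : H * t / G s = H * k := by rw [hk]; field_simp
    have e3 : (1 - G' s) * k ^ 2 ≤ (G s - s * G' s) / G s ^ 2 := by
      rw [hk, div_pow, ← mul_div_assoc]
      refine div_le_div_of_nonneg_right ?_ (by positivity)
      nlinarith [h0 s, h1 s, hGs s, mul_le_mul_of_nonneg_left ht (sub_nonneg.2 (h1 s))]
    have e4 : S.indicator (fun _ => 1 / (2 * a)) z ≤ (G s - s * G' s) / G s ^ 2 := by
      by_cases hzS : z ∈ S
      · rw [indicator_of_mem hzS, (hGa s hzS).1, (hGa s hzS).2]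
        field_simp; simp
      · rw [indicator_of_notMem hzS]
        exact div_nonneg (sub_nonneg.2 (hsG s)) (by positivity)
    have e5 : 2 * (G s - s * G' s) / G s ^ 2 = 2 * ((G s - s * G' s) / G s ^ 2) := by ring
    rw [e1, e2, e5]
    have e6 : G' s * (H * k) ≤ 2 * G' s * k ^ 2 + H ^ 2 / 8 := by
      nlinarith [mul_nonneg (h0 s) (sq_nonneg (4 * k - H)),
        mul_nonneg (sub_nonneg.2 (h1 s)) (sq_nonneg H)]
    have e7 : (1 - G' s) * (H * k) ≤ (1 - G' s) * k ^ 2 + H ^ 2 / 4 := by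
      nlinarith [mul_nonneg (sub_nonneg.2 (h1 s)) (sq_nonneg (2 * k - H)),
        mul_nonneg (h0 s) (sq_nonneg H)]
    linarith
  rw [hF0, integral_sub hSi (hH2.const_mul _), integral_indicator_const _ hS,
    integral_const_mul, smul_eq_mul] at hle
  have h3 : 1 / (2 * a) * (2 * a) = 1 := by field_simp
  set A := (μHE[2].restrict (frontier E)).real S
  set Q := ∫ z in frontier E, meanCurvature E z ^ 2 ∂μHE[2]
  have h4 : (A * (1 / (2 * a)) - 3 / 8 * Q) * (2 * a) ≤ 0 :=
    mul_nonpos_of_nonpos_of_nonneg hle (by positivity)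
  linear_combination h4 - A * h3

/-- The sharp local area bound. The error term is the contribution of the normal component of the
position vector in a slightly larger ball. -/
theorem IsC2Regular.area_le_of_annulus (hE : IsC2Regular E) (hb : Bornology.IsBounded E) (x₀ : R3)
    {a b : ℝ} (ha : 0 < a) (hab : a < b) :
    (μHE[2].restrict (frontier E)).real {z | ‖z - x₀‖ ^ 2 ≤ a} ≤
      (a + b) / 32 * ∫ z in frontier E, meanCurvature E z ^ 2 ∂μHE[2] +
      1 / 2 * ∫ z in frontier E, {z | ‖z - x₀‖ ^ 2 < b}.indicator
        (fun z => |meanCurvature E z| * |⟪z - x₀, outerNormal E z⟫|) z ∂μHE[2] := by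
  have := hE.isFiniteMeasure hb
  obtain ⟨G, G', hG, hG'c, hGc0, hGs, h0, h1, hsG, hGa, hGb⟩ := exists_convex_cutoff ha.le hab
  set c := (a + b) / 2 with hc
  have hcpos : 0 < c := by rw [hc]; linarith
  have hpos : ∀ s, 0 < G s := fun s => hcpos.trans_le (hGc0 s)
  obtain ⟨F, hFi, hF0, hF⟩ := hE.integral_radial hb x₀ hG hG'c hpos
  set S := {z : R3 | ‖z - x₀‖ ^ 2 ≤ a}
  set B := {z : R3 | ‖z - x₀‖ ^ 2 < b}
  have hS : MeasurableSet S := measurableSet_norm_sub_sq_le x₀ a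
  have hB : MeasurableSet B := measurableSet_norm_sub_sq_lt x₀ b
  have hH2 : Integrable (fun z => meanCurvature E z ^ 2) (μHE[2].restrict (frontier E)) :=
    hE.integrableOn hb (hE.continuousOn_meanCurvature.pow 2)
  have hSi : Integrable (S.indicator fun _ => 2 / c) (μHE[2].restrict (frontier E)) :=
    (integrable_const _).indicator hS
  set W : R3 → ℝ := fun z => |meanCurvature E z| * |⟪z - x₀, outerNormal E z⟫| with hW
  have hBi : Integrable (B.indicator W) (μHE[2].restrict (frontier E)) :=
    (hE.integrableOn hb (hE.continuousOn_abs_mul_abs x₀)).indicator hB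
  have hle : ∫ z in frontier E, (S.indicator (fun _ => 2 / c) z
      - (1 / 8 * meanCurvature E z ^ 2 + 1 / c * B.indicator W z)) ∂μHE[2] ≤
      ∫ z in frontier E, F z ∂μHE[2] := by
    refine setIntegral_mono_on (hSi.sub ((hH2.const_mul _).add (hBi.const_mul _))) hFi
      isClosed_frontier.measurableSet ?_
    intro z hz
    rw [hF z hz]
    have hWz : W z = |meanCurvature E z * ⟪z - x₀, outerNormal E z⟫| := (abs_mul _ _).symm
    have hBz : z ∉ B → b ≤ ‖z - x₀‖ ^ 2 := fun h => not_lt.1 h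
    set s := ‖z - x₀‖ ^ 2 with hs
    set t := ⟪z - x₀, outerNormal E z⟫
    set H := meanCurvature E z
    have hp := hpos s
    set k := t / G s with hk
    have e1 : 2 * G' s * t ^ 2 / G s ^ 2 = 2 * G' s * k ^ 2 := by rw [hk]; field_simp
    have e2 : H * t / G s = H * k := by rw [hk]; field_simp
    have e4 : S.indicator (fun _ => 2 / c) z ≤ 2 * (G s - s * G' s) / G s ^ 2 := by
      by_cases hzS : z ∈ S
      · rw [indicator_of_mem hzS, (hGa s hzS).1, (hGa s hzS).2]
        field_simp; simp
      · rw [indicator_of_notMem hzS]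
        exact div_nonneg (mul_nonneg zero_le_two (sub_nonneg.2 (hsG s))) (by positivity)
    have e6 : G' s * (H * k) ≤ 2 * G' s * k ^ 2 + H ^ 2 / 8 := by
      nlinarith [mul_nonneg (h0 s) (sq_nonneg (4 * k - H)),
        mul_nonneg (sub_nonneg.2 (h1 s)) (sq_nonneg H)]
    -- outside the larger ball `G' = 1`, so that there is no error term
    have e7 : (1 - G' s) * (H * k) ≤ 1 / c * B.indicator W z := by
      by_cases hzB : z ∈ B
      · rw [indicator_of_mem hzB, hWz]
        have h2 : H * k ≤ 1 / c * |H * t| := by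
          rw [← e2, one_div_mul_eq_div]
          calc H * t / G s ≤ |H * t| / G s := by gcongr; exact le_abs_self _
            _ ≤ |H * t| / c := by gcongr; exact hGc0 s
        have h3 : 0 ≤ 1 / c * |H * t| := by positivity
        calc (1 - G' s) * (H * k) ≤ (1 - G' s) * (1 / c * |H * t|) :=
              mul_le_mul_of_nonneg_left h2 (sub_nonneg.2 (h1 s))
          _ ≤ 1 * (1 / c * |H * t|) := mul_le_mul_of_nonneg_right (by linarith [h0 s]) h3
          _ = _ := one_mul _
      · rw [indicator_of_notMem hzB, hGb s (hBz hzB)]; simp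
    rw [e1, e2]
    linarith
  have hR : Integrable (fun z => 1 / 8 * meanCurvature E z ^ 2 + 1 / c * B.indicator W z)
      (μHE[2].restrict (frontier E)) := (hH2.const_mul _).add (hBi.const_mul _)
  rw [hF0, integral_sub hSi hR, integral_add (hH2.const_mul _) (hBi.const_mul _), integral_indicator_const _ hS,
    integral_const_mul, integral_const_mul, smul_eq_mul] at hle
  have h3 : (a + b) / 32 = c / 16 := by rw [hc]; ring
  rw [h3]
  set A := (μHE[2].restrict (frontier E)).real S
  set Q := ∫ z in frontier E, meanCurvature E z ^ 2 ∂μHE[2]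
  set I := ∫ z in frontier E, B.indicator W z ∂μHE[2]
  have h4 : (A * (2 / c) - (1 / 8 * Q + 1 / c * I)) * (c / 2) ≤ 0 :=
    mul_nonpos_of_nonpos_of_nonneg hle (by positivity)
  have h5 : (A * (2 / c) - (1 / 8 * Q + 1 / c * I)) * (c / 2) = A - (c / 16 * Q + 1 / 2 * I) := by
    field_simp; ring
  linarith

theorem IsC2Regular.area_le_sharp (hE : IsC2Regular E) (hb : Bornology.IsBounded E) (x₀ : R3)
    {a b : ℝ} (ha : 0 < a) (hab : a < b) :
    (μHE[2].restrict (frontier E)).real {z | ‖z - x₀‖ ^ 2 ≤ a} ≤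
      a / 16 * ∫ z in frontier E, meanCurvature E z ^ 2 ∂μHE[2] +
      1 / 2 * ∫ z in frontier E, {z | ‖z - x₀‖ ^ 2 < b}.indicator
        (fun z => |meanCurvature E z| * |⟪z - x₀, outerNormal E z⟫|) z ∂μHE[2] := by
  set W : R3 → ℝ := fun z => |meanCurvature E z| * |⟪z - x₀, outerNormal E z⟫|
  have hWi : Integrable W (μHE[2].restrict (frontier E)) :=
    hE.integrableOn hb (hE.continuousOn_abs_mul_abs x₀)
  have hlim : Filter.Tendsto (fun b' : ℝ =>
      (a + b') / 32 * ∫ z in frontier E, meanCurvature E z ^ 2 ∂μHE[2] +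
      1 / 2 * ∫ z in frontier E, {z | ‖z - x₀‖ ^ 2 < b}.indicator W z ∂μHE[2]) (𝓝[>] a)
      (𝓝 ((a + a) / 32 * ∫ z in frontier E, meanCurvature E z ^ 2 ∂μHE[2] +
      1 / 2 * ∫ z in frontier E, {z | ‖z - x₀‖ ^ 2 < b}.indicator W z ∂μHE[2])) := by
    refine Filter.Tendsto.mono_left (Continuous.tendsto ?_ a) nhdsWithin_le_nhds
    fun_prop
  rw [show a / 16 = (a + a) / 32 by ring]
  refine ge_of_tendsto hlim ?_
  filter_upwards [Ioo_mem_nhdsGT hab] with b' hb'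
  refine (hE.area_le_of_annulus hb x₀ ha hb'.1).trans ?_
  have hmono : ∫ z in frontier E, {z | ‖z - x₀‖ ^ 2 < b'}.indicator W z ∂μHE[2] ≤
      ∫ z in frontier E, {z | ‖z - x₀‖ ^ 2 < b}.indicator W z ∂μHE[2] :=
    integral_mono (hWi.indicator (measurableSet_norm_sub_sq_lt x₀ b'))
      (hWi.indicator (measurableSet_norm_sub_sq_lt x₀ b)) fun z =>
      indicator_le_indicator_of_subset (fun z hz => lt_trans hz hb'.2) (fun z => by positivity) z
  linarith

/-! ### The tilt estimate -/

/-- The Cauchy-Schwarz inequality for the projections of `a` and `b` to the orthogonal complement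
of the unit vector `e`. -/
theorem sq_inner_sub_le {a b e : R3} (he : ‖e‖ = 1) :
    (⟪a, b⟫ - ⟪a, e⟫ * ⟪b, e⟫) ^ 2 ≤ (‖a‖ ^ 2 - ⟪a, e⟫ ^ 2) * (‖b‖ ^ 2 - ⟪b, e⟫ ^ 2) := by
  have he2 : ⟪e, e⟫ = 1 := by rw [real_inner_self_eq_norm_sq, he]; norm_num
  have key : ∀ u v : R3, ⟪u - ⟪u, e⟫ • e, v - ⟪v, e⟫ • e⟫ = ⟪u, v⟫ - ⟪u, e⟫ * ⟪v, e⟫ := by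
    intro u v
    simp only [inner_sub_left, inner_sub_right, inner_smul_left, inner_smul_right, he2,
      conj_trivial, real_inner_comm v e]
    ring
  have h := real_inner_mul_inner_self_le (a - ⟪a, e⟫ • e) (b - ⟪b, e⟫ • e)
  rw [key, key, key, real_inner_self_eq_norm_sq, real_inner_self_eq_norm_sq] at h
  linarith

theorem hasFDerivAt_inner_sub (x₀ ω z : R3) :
    HasFDerivAt (fun z : R3 => ⟪z - x₀, ω⟫) (innerSL ℝ ω) z := by
  have h1 : (fun z : R3 => ⟪z - x₀, ω⟫) = fun z => innerSL ℝ ω z - ⟪x₀, ω⟫ := by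
    funext z
    rw [inner_sub_left, innerSL_apply_apply, real_inner_comm]
  rw [h1]
  exact (innerSL ℝ ω).hasFDerivAt.sub_const _

/-- The first variation formula for the field `((c - |z - x₀|²)₊)² ⟪z - x₀, ω⟫ ω`. -/
theorem IsC2Regular.integral_height (hE : IsC2Regular E) (hb : Bornology.IsBounded E) (x₀ : R3)
    {ω : R3} (hω : ‖ω‖ = 1) (c : ℝ) :
    ∃ F : R3 → ℝ, Integrable F (μHE[2].restrict (frontier E)) ∧
      ∫ z in frontier E, F z ∂μHE[2] = 0 ∧ ∀ z ∈ frontier E, F z =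
        max (c - ‖z - x₀‖ ^ 2) 0 ^ 2 * (1 - ⟪ω, outerNormal E z⟫ ^ 2)
        - 4 * max (c - ‖z - x₀‖ ^ 2) 0 * ⟪z - x₀, ω⟫ *
          (⟪z - x₀, ω⟫ - ⟪z - x₀, outerNormal E z⟫ * ⟪ω, outerNormal E z⟫)
        - meanCurvature E z *
          (max (c - ‖z - x₀‖ ^ 2) 0 ^ 2 * ⟪z - x₀, ω⟫ * ⟪ω, outerNormal E z⟫) := by
  set ζ : ℝ → ℝ := fun s => max (c - s) 0 ^ 2
  set ζ' : ℝ → ℝ := fun s => -(2 * max (c - s) 0)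
  have hζ : ∀ s, HasDerivAt ζ (ζ' s) s := fun s =>
    (hasDerivAt_sq_max_zero (c - s)).comp_const_sub c s
  have hζC := contDiff_one_of_hasDerivAt hζ (by fun_prop)
  set X : R3 → R3 := fun z => (ζ (‖z - x₀‖ ^ 2) * ⟪z - x₀, ω⟫) • ω
  have hX : ContDiff ℝ 1 X := by
    have h1 : ContDiff ℝ 1 fun z : R3 => z - x₀ := contDiff_id.sub contDiff_const
    exact ((hζC.comp (h1.norm_sq ℝ)).mul (h1.inner ℝ contDiff_const)).smul contDiff_const
  have hX' : ∀ z, HasFDerivAt X ((0 : ℝ) • ContinuousLinearMap.id ℝ R3 +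
      InnerProductSpace.rankOne ℝ ω (ζ (‖z - x₀‖ ^ 2) • ω +
        (2 * ζ' (‖z - x₀‖ ^ 2) * ⟪z - x₀, ω⟫) • (z - x₀))) z := by
    intro z
    have h1 := (hζ (‖z - x₀‖ ^ 2)).comp_hasFDerivAt z (hasFDerivAt_norm_sub_sq x₀ z)
    have h2 := (h1.mul (hasFDerivAt_inner_sub x₀ ω z)).smul_const ω
    convert! h2 using 1
    ext1 v
    simp only [zero_smul, zero_add, add_apply, smul_apply,
      InnerProductSpace.rankOne_apply, inner_add_left, inner_smul_left, conj_trivial,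
      Function.comp_apply, ContinuousLinearMap.smulRight_apply, innerSL_apply_apply, smul_eq_mul]
    congr 1
    ring
  refine ⟨firstVariationDensity E X, hE.integrableOn hb
    (hE.continuousOn_firstVariationDensity hX), hE.integral_firstVariationDensity hb hX,
    fun z hz => ?_⟩
  have hn := hE.norm_outerNormal hz
  rw [firstVariationDensity, (hX' z).fderiv, tangentialTrace_smul_id_add_rankOne _ _ _ hn]
  simp only [X, inner_smul_left, inner_add_left, conj_trivial, real_inner_self_eq_norm_sq, hω]
  simp only [ζ, ζ']
  ring

/-- If the boundary of `E` lies in a slab of half-width `η` within a ball of radius `√c`, then the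
`L²` deviation of its tangent planes from the direction of the slab is small. -/
theorem IsC2Regular.tilt_le (hE : IsC2Regular E) (hb : Bornology.IsBounded E) (x₀ : R3)
    {ω : R3} (hω : ‖ω‖ = 1) {c η r : ℝ} (hc : 0 < c) (hη : 0 ≤ η) (hr : 0 < r)
    (hslab : ∀ z ∈ frontier E, ‖z - x₀‖ ^ 2 < c → |⟪z - x₀, ω⟫| ≤ η) :
    Integrable (fun z => max (c - ‖z - x₀‖ ^ 2) 0 ^ 2 * (1 - ⟪ω, outerNormal E z⟫ ^ 2))
      (μHE[2].restrict (frontier E)) ∧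
    1 / 2 * ∫ z in frontier E, max (c - ‖z - x₀‖ ^ 2) 0 ^ 2 * (1 - ⟪ω, outerNormal E z⟫ ^ 2) ∂μHE[2]
      ≤ (8 * η ^ 2 * c + c ^ 2 * η / (2 * r)) *
          (μHE[2].restrict (frontier E)).real {z | ‖z - x₀‖ ^ 2 < c} +
        c ^ 2 * η * r / 2 * ∫ z in frontier E, meanCurvature E z ^ 2 ∂μHE[2] := by
  have := hE.isFiniteMeasure hb
  obtain ⟨F, hFi, hF0, hF⟩ := hE.integral_height hb x₀ hω c
  set B := {z : R3 | ‖z - x₀‖ ^ 2 < c}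
  have hB : MeasurableSet B := measurableSet_norm_sub_sq_lt x₀ c
  set k := 8 * η ^ 2 * c + c ^ 2 * η / (2 * r) with hk
  set T : R3 → ℝ := fun z =>
    max (c - ‖z - x₀‖ ^ 2) 0 ^ 2 * (1 - ⟪ω, outerNormal E z⟫ ^ 2)
  have hTi : Integrable T (μHE[2].restrict (frontier E)) := by
    refine hE.integrableOn hb (ContinuousOn.mul ?_ (continuousOn_const.sub
      ((continuousOn_const.inner hE.continuousOn_outerNormal).pow 2)))
    exact Continuous.continuousOn (by fun_prop)
  have hH2 : Integrable (fun z => meanCurvature E z ^ 2) (μHE[2].restrict (frontier E)) :=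
    hE.integrableOn hb (hE.continuousOn_meanCurvature.pow 2)
  have hBi : Integrable (B.indicator fun _ => k) (μHE[2].restrict (frontier E)) :=
    (integrable_const _).indicator hB
  have hR : Integrable (fun z => B.indicator (fun _ => k) z +
      c ^ 2 * η * r / 2 * meanCurvature E z ^ 2) (μHE[2].restrict (frontier E)) :=
    hBi.add (hH2.const_mul _)
  refine ⟨hTi, ?_⟩
  have hle : ∫ z in frontier E, (1 / 2 * T z - (B.indicator (fun _ => k) z +
      c ^ 2 * η * r / 2 * meanCurvature E z ^ 2)) ∂μHE[2] ≤ ∫ z in frontier E, F z ∂μHE[2] := by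
    refine setIntegral_mono_on ((hTi.const_mul _).sub hR) hFi isClosed_frontier.measurableSet ?_
    intro z hz
    rw [hF z hz]
    have hn := hE.norm_outerNormal hz
    have hκ := sq_inner_sub_le (a := z - x₀) (b := ω) hn
    have hν := sq_inner_le_norm_sq (y := ω) hn
    rw [hω, one_pow] at hκ hν
    change 1 / 2 * (max (c - ‖z - x₀‖ ^ 2) 0 ^ 2 * (1 - ⟪ω, outerNormal E z⟫ ^ 2)) - _ ≤ _
    have hs0 : 0 ≤ ‖z - x₀‖ ^ 2 := by positivity
    have hh := hslab z hz
    have hBz : z ∈ B ↔ ‖z - x₀‖ ^ 2 < c := Iff.rfl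
    generalize ‖z - x₀‖ ^ 2 = s at *
    generalize ⟪z - x₀, ω⟫ = h at *
    generalize ⟪ω, outerNormal E z⟫ = ν at *
    generalize ⟪z - x₀, outerNormal E z⟫ = t at *
    generalize meanCurvature E z = H at *
    by_cases hzB : z ∈ B
    · have hsc := hBz.1 hzB
      rw [indicator_of_mem hzB, max_eq_left (by linarith)]
      have hhη := hh hsc
      set m := c - s with hm
      have hm0 : 0 < m := by linarith
      have hmc : m ≤ c := by linarith
      have hh2 : h ^ 2 ≤ η ^ 2 := sq_le_sq' (by linarith [abs_le.1 hhη]) (abs_le.1 hhη).2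
      set τ := 1 - ν ^ 2 with hτ
      have hτ0 : 0 ≤ τ := by linarith
      set κ := h - t * ν
      have hκ2 : κ ^ 2 ≤ s * τ := hκ.trans (by nlinarith [sq_nonneg t])
      have e1 : 4 * m * h * κ ≤ 1 / 2 * (m ^ 2 * τ) + 8 * h ^ 2 * s := by
        refine (abs_le_of_sq_le_sq' ?_ (by positivity)).2
        have : (4 * m * h * κ) ^ 2 ≤ 16 * m ^ 2 * h ^ 2 * (s * τ) := by
          calc _ = 16 * m ^ 2 * h ^ 2 * κ ^ 2 := by ring
            _ ≤ _ := by gcongr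
        nlinarith [sq_nonneg (1 / 2 * (m ^ 2 * τ) - 8 * h ^ 2 * s)]
      have e2 : 8 * h ^ 2 * s ≤ 8 * η ^ 2 * c := by gcongr
      have e3 : H * (m ^ 2 * h * ν) ≤ c ^ 2 * η * |H| := by
        have hν1 : |ν| ≤ 1 := by rw [← sq_le_one_iff_abs_le_one]; exact hν
        calc H * (m ^ 2 * h * ν) ≤ |H * (m ^ 2 * h * ν)| := le_abs_self _
          _ = m ^ 2 * |h| * |ν| * |H| := by
              rw [abs_mul, abs_mul, abs_mul, abs_of_nonneg (sq_nonneg m)]; ring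
          _ ≤ c ^ 2 * η * 1 * |H| := by gcongr
          _ = _ := by ring
      have e4 : |H| ≤ r / 2 * H ^ 2 + 1 / (2 * r) := by
        have : 0 ≤ (r * |H| - 1) ^ 2 / (2 * r) := by positivity
        have h2 : (r * |H| - 1) ^ 2 / (2 * r) = r / 2 * H ^ 2 + 1 / (2 * r) - |H| := by
          rw [← sq_abs H]; field_simp; ring
        linarith
      have e5 : c ^ 2 * η * |H| ≤ c ^ 2 * η * r / 2 * H ^ 2 + c ^ 2 * η / (2 * r) := by
        calc _ ≤ c ^ 2 * η * (r / 2 * H ^ 2 + 1 / (2 * r)) := by gcongr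
          _ = _ := by ring
      rw [hk]
      linarith
    · have hsc : c ≤ s := not_lt.1 fun hlt => hzB (hBz.2 hlt)
      rw [indicator_of_notMem hzB, max_eq_right (by linarith)]
      have : 0 ≤ c ^ 2 * η * r / 2 * H ^ 2 := by positivity
      simpa using this
  rw [hF0, integral_sub (hTi.const_mul _) hR, integral_add hBi (hH2.const_mul _),
    integral_const_mul, integral_const_mul, integral_indicator_const _ hB, smul_eq_mul] at hle
  linarith

/-- In a slab of half-width `ρ θ²` the error term of the sharp area bound is of order `θ ρ²`. -/
theorem IsC2Regular.integral_abs_mul_abs_le (hE : IsC2Regular E) (hb : Bornology.IsBounded E)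
    (x₀ : R3) {ω : R3} (hω : ‖ω‖ = 1) {ρ θ : ℝ} (hρ : 0 < ρ) (hθ : 0 < θ) (hθ1 : θ ≤ 1)
    (hslab : ∀ z ∈ frontier E, ‖z - x₀‖ ^ 2 < 4 * ρ ^ 2 → |⟪z - x₀, ω⟫| ≤ ρ * θ ^ 2) :
    ∫ z in frontier E, {z | ‖z - x₀‖ ^ 2 < 9 / 4 * ρ ^ 2}.indicator
        (fun z => |meanCurvature E z| * |⟪z - x₀, outerNormal E z⟫|) z ∂μHE[2] ≤
      196 * ρ ^ 2 * θ * ∫ z in frontier E, meanCurvature E z ^ 2 ∂μHE[2] := by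
  have := hE.isFiniteMeasure hb
  obtain ⟨hTi, htilt⟩ := hE.tilt_le hb x₀ hω (c := 4 * ρ ^ 2) (η := ρ * θ ^ 2) (r := ρ)
    (by positivity) (by positivity) hρ hslab
  have harea := hE.area_le hb x₀ (a := 4 * ρ ^ 2) (by positivity)
  set Q := ∫ z in frontier E, meanCurvature E z ^ 2 ∂μHE[2]
  have hQ : 0 ≤ Q := integral_nonneg fun z => sq_nonneg _
  set T : R3 → ℝ := fun z =>
    max (4 * ρ ^ 2 - ‖z - x₀‖ ^ 2) 0 ^ 2 * (1 - ⟪ω, outerNormal E z⟫ ^ 2)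
  set M := ∫ z in frontier E, T z ∂μHE[2]
  set B := {z : R3 | ‖z - x₀‖ ^ 2 < 4 * ρ ^ 2}
  set A := (μHE[2].restrict (frontier E)).real B
  have hA : A ≤ 3 * ρ ^ 2 * Q := by
    have h1 : A ≤ (μHE[2].restrict (frontier E)).real {z | ‖z - x₀‖ ^ 2 ≤ 4 * ρ ^ 2} :=
      measureReal_mono (fun z hz => le_of_lt (show ‖z - x₀‖ ^ 2 < 4 * ρ ^ 2 from hz))
        (measure_ne_top _ _)
    linarith
  have hM : M ≤ 256 * ρ ^ 6 * θ ^ 2 * Q := by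
    have h1 : (8 * (ρ * θ ^ 2) ^ 2 * (4 * ρ ^ 2) + (4 * ρ ^ 2) ^ 2 * (ρ * θ ^ 2) / (2 * ρ)) * A ≤
        (8 * (ρ * θ ^ 2) ^ 2 * (4 * ρ ^ 2) + (4 * ρ ^ 2) ^ 2 * (ρ * θ ^ 2) / (2 * ρ)) *
          (3 * ρ ^ 2 * Q) := by gcongr
    have h2 : (4 * ρ ^ 2) ^ 2 * (ρ * θ ^ 2) / (2 * ρ) = 8 * ρ ^ 4 * θ ^ 2 := by field_simp; ring
    rw [h2] at h1 htilt
    have h3 : θ ^ 4 ≤ θ ^ 2 := pow_le_pow_of_le_one hθ.le hθ1 (by norm_num)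
    have h4 : ρ ^ 6 * Q * θ ^ 4 ≤ ρ ^ 6 * Q * θ ^ 2 := by gcongr
    linarith
  have hB : MeasurableSet B := measurableSet_norm_sub_sq_lt x₀ _
  set k := ρ ^ 2 * θ ^ 4 / (ρ ^ 2 * θ) with hk
  set l := 3 / (4 * ρ ^ 4 * θ) with hl
  have hH2 : Integrable (fun z => meanCurvature E z ^ 2) (μHE[2].restrict (frontier E)) :=
    hE.integrableOn hb (hE.continuousOn_meanCurvature.pow 2)
  have hBi : Integrable (B.indicator fun _ => k) (μHE[2].restrict (frontier E)) :=
    (integrable_const _).indicator hB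
  have hle : ∫ z in frontier E, {z | ‖z - x₀‖ ^ 2 < 9 / 4 * ρ ^ 2}.indicator
        (fun z => |meanCurvature E z| * |⟪z - x₀, outerNormal E z⟫|) z ∂μHE[2] ≤
      ∫ z in frontier E, ((ρ ^ 2 * θ / 2 * meanCurvature E z ^ 2 + B.indicator (fun _ => k) z)
        + l * T z) ∂μHE[2] := by
    refine setIntegral_mono_on ((hE.integrableOn hb (hE.continuousOn_abs_mul_abs x₀)).indicator
      (measurableSet_norm_sub_sq_lt x₀ _)) (((hH2.const_mul _).add hBi).add (hTi.const_mul _))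
      isClosed_frontier.measurableSet fun z hz => ?_
    have hn := hE.norm_outerNormal hz
    have hκ := sq_inner_sub_le (a := z - x₀) (b := outerNormal E z) hω
    have hν := sq_inner_le_norm_sq (y := ω) hn
    rw [hn, one_pow, real_inner_comm ω (outerNormal E z)] at hκ
    rw [hω, one_pow] at hν
    change _ ≤ _ + l * (max (4 * ρ ^ 2 - ‖z - x₀‖ ^ 2) 0 ^ 2 * (1 - ⟪ω, outerNormal E z⟫ ^ 2))
    have hs0 : 0 ≤ ‖z - x₀‖ ^ 2 := by positivity
    have hh := hslab z hz
    have hBz : z ∈ B ↔ ‖z - x₀‖ ^ 2 < 4 * ρ ^ 2 := Iff.rfl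
    have hk0 : 0 ≤ k := by positivity
    have hl0 : 0 ≤ l := by positivity
    by_cases hzB : ‖z - x₀‖ ^ 2 < 9 / 4 * ρ ^ 2
    · rw [indicator_of_mem (show z ∈ {z | ‖z - x₀‖ ^ 2 < 9 / 4 * ρ ^ 2} from hzB)]
      have hs4 : ‖z - x₀‖ ^ 2 < 4 * ρ ^ 2 := by nlinarith [sq_pos_of_pos hρ]
      rw [indicator_of_mem (hBz.2 hs4)]
      have hhη := hh hs4
      generalize ‖z - x₀‖ ^ 2 = s at *
      generalize ⟪z - x₀, ω⟫ = h at *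
      generalize ⟪ω, outerNormal E z⟫ = ν at *
      generalize ⟪z - x₀, outerNormal E z⟫ = t at *
      generalize meanCurvature E z = H at *
      have hh2 : h ^ 2 ≤ (ρ * θ ^ 2) ^ 2 :=
        sq_le_sq' (by linarith [abs_le.1 hhη]) (abs_le.1 hhη).2
      set τ := 1 - ν ^ 2 with hτ
      have hτ0 : 0 ≤ τ := by linarith
      have hsτ : s * τ ≤ 9 / 4 * ρ ^ 2 * τ := by gcongr
      have ht : t ^ 2 ≤ 2 * (ρ * θ ^ 2) ^ 2 + 9 / 2 * ρ ^ 2 * τ := by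
        have h1 : (t - h * ν) ^ 2 ≤ s * τ := hκ.trans (by nlinarith [sq_nonneg h])
        nlinarith [sq_nonneg (t - 2 * h * ν), mul_le_mul_of_nonneg_left hν (sq_nonneg h)]
      have hm : 3 * ρ ^ 4 ≤ max (4 * ρ ^ 2 - s) 0 ^ 2 := by
        have h1 : 7 / 4 * ρ ^ 2 ≤ max (4 * ρ ^ 2 - s) 0 := le_max_of_le_left (by linarith)
        calc 3 * ρ ^ 4 ≤ (7 / 4 * ρ ^ 2) ^ 2 := by nlinarith [pow_pos hρ 4]
          _ ≤ _ := by gcongr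
      have e1 : |H| * |t| ≤ ρ ^ 2 * θ / 2 * H ^ 2 + t ^ 2 / (2 * (ρ ^ 2 * θ)) := by
        have h1 : 0 ≤ (ρ ^ 2 * θ * |H| - |t|) ^ 2 / (2 * (ρ ^ 2 * θ)) := by positivity
        have h2 : (ρ ^ 2 * θ * |H| - |t|) ^ 2 / (2 * (ρ ^ 2 * θ)) =
            ρ ^ 2 * θ / 2 * H ^ 2 + t ^ 2 / (2 * (ρ ^ 2 * θ)) - |H| * |t| := by
          rw [← sq_abs H, ← sq_abs t]; field_simp; ring
        linarith
      have e2 : t ^ 2 / (2 * (ρ ^ 2 * θ)) ≤ k + l * (3 * ρ ^ 4 * τ) := by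
        have h1 : (2 * (ρ * θ ^ 2) ^ 2 + 9 / 2 * ρ ^ 2 * τ) / (2 * (ρ ^ 2 * θ)) =
            k + l * (3 * ρ ^ 4 * τ) := by
          rw [hk, hl]; field_simp; ring
        rw [← h1]
        gcongr
      have e3 : l * (3 * ρ ^ 4 * τ) ≤ l * (max (4 * ρ ^ 2 - s) 0 ^ 2 * τ) := by gcongr
      linarith
    · rw [indicator_of_notMem (show z ∉ {z | ‖z - x₀‖ ^ 2 < 9 / 4 * ρ ^ 2} from hzB)]
      have h1 : 0 ≤ B.indicator (fun _ => k) z := indicator_nonneg (fun _ _ => hk0) z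
      have h2 : 0 ≤ 1 - ⟪ω, outerNormal E z⟫ ^ 2 := by linarith
      positivity
  refine hle.trans ?_
  have hsum : Integrable (fun z => ρ ^ 2 * θ / 2 * meanCurvature E z ^ 2 +
      B.indicator (fun _ => k) z) (μHE[2].restrict (frontier E)) := (hH2.const_mul _).add hBi
  rw [integral_add hsum (hTi.const_mul _), integral_add (hH2.const_mul _) hBi,
    integral_const_mul, integral_const_mul, integral_indicator_const _ hB, smul_eq_mul]
  have h1 : A * k ≤ 3 * ρ ^ 2 * Q * k := by gcongr
  have h2 : l * M ≤ l * (256 * ρ ^ 6 * θ ^ 2 * Q) := by gcongr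
  have h3 : 3 * ρ ^ 2 * Q * k = 3 * ρ ^ 2 * Q * θ ^ 3 := by rw [hk]; field_simp
  have h4 : l * (256 * ρ ^ 6 * θ ^ 2 * Q) = 192 * ρ ^ 2 * θ * Q := by
    rw [hl]; field_simp; ring
  have h5 : θ ^ 3 ≤ θ := by
    simpa using pow_le_pow_of_le_one hθ.le hθ1 (show 1 ≤ 3 by norm_num)
  have h6 : 3 * ρ ^ 2 * Q * θ ^ 3 ≤ 3 * ρ ^ 2 * Q * θ := by gcongr
  have h7 : 0 ≤ ρ ^ 2 * θ * Q := by positivity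
  change ρ ^ 2 * θ / 2 * Q + A * k + l * M ≤ _
  linarith

end C2Set

/-! ### The area bound -/

theorem proposition3p1 (α δ : ℝ) (hα : α ∈ Set.Ioo (0 : ℝ) 1) (hδ : δ ∈ Set.Ioo (0 : ℝ) 1) :
    ∃ ρ₀ : ℝ, 0 < ρ₀ ∧
      ∀ (x₀ ω : EuclideanSpace ℝ (Fin 3)), ‖ω‖ = 1 →
      ∀ ρ : ℝ, 0 < ρ → ρ ≤ ρ₀ →
      ∀ E : Set (EuclideanSpace ℝ (Fin 3)),
        Bornology.IsBounded E → C2Set.IsC2Regular E →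
        C2Set.willmoreEnergy E ≤ ENNReal.ofReal (8 * Real.pi - δ) →
        frontier E ∩ Metric.ball x₀ (2 * ρ) ⊆
          {x | |inner ℝ (x - x₀) ω| ≤ ρ ^ (1 + α)} →
        μHE[2] (frontier E ∩ Metric.ball x₀ ρ) ≤
          ENNReal.ofReal ((2 * Real.pi - δ / 6) * ρ ^ 2) := by
  have hα0 := hα.1
  have hδ0 := hδ.1
  -- the error term is at most `98 θ Q ρ²`, where `θ = ρ ^ (α / 2)` and `Q ≤ 32 π < 128`
  have hd : (0 : ℝ) < δ / 160000 := by positivity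
  refine ⟨(δ / 160000) ^ (2 / α), Real.rpow_pos_of_pos hd _, ?_⟩
  intro x₀ ω hω ρ hρ hρ₀ E hb hE hW hslab
  set θ := ρ ^ (α / 2) with hθdef
  have hθ : 0 < θ := Real.rpow_pos_of_pos hρ _
  have hθd : θ ≤ δ / 160000 := by
    calc θ ≤ ((δ / 160000) ^ (2 / α)) ^ (α / 2) := Real.rpow_le_rpow hρ.le hρ₀ (by positivity)
      _ = δ / 160000 := by
          rw [← Real.rpow_mul hd.le, show 2 / α * (α / 2) = 1 by field_simp, Real.rpow_one]
  have hθ1 : θ ≤ 1 := by linarith [hδ.2]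
  have hη : ρ ^ (1 + α) = ρ * θ ^ 2 := by
    rw [Real.rpow_add hρ, Real.rpow_one, hθdef, ← Real.rpow_natCast, ← Real.rpow_mul hρ.le]
    norm_num
  have hpi3 := Real.pi_gt_three
  have hpi4 := Real.pi_le_four
  have hw : 0 ≤ 8 * Real.pi - δ := by linarith [hδ.2]
  have hQ := hE.integral_sq_meanCurvature_le hb hw hW
  have hball : ∀ r : ℝ, 0 < r → ∀ z : C2Set.R3, z ∈ Metric.ball x₀ r ↔ ‖z - x₀‖ ^ 2 < r ^ 2 :=
    fun r hr z => by
      rw [mem_ball_iff_norm, sq_lt_sq₀ (norm_nonneg _) hr.le]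
  have hI := hE.integral_abs_mul_abs_le hb x₀ hω hρ hθ hθ1 fun z hz hzs => by
    rw [← hη]
    exact hslab ⟨hz, (hball (2 * ρ) (by positivity) z).2 (by linarith)⟩
  have hA := hE.area_le_sharp hb x₀ (a := ρ ^ 2) (b := 9 / 4 * ρ ^ 2) (by positivity)
    (by nlinarith [sq_pos_of_pos hρ])
  set Q := ∫ z in frontier E, C2Set.meanCurvature E z ^ 2 ∂μHE[2]
  have hfin := hE.isFiniteMeasure hb
  rw [inter_comm, ← Measure.restrict_apply Metric.isOpen_ball.measurableSet,
    ENNReal.le_ofReal_iff_toReal_le (measure_ne_top _ _) (by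
      have : 0 ≤ 2 * Real.pi - δ / 6 := by linarith [hδ.2]
      positivity)]
  calc ((μHE[2].restrict (frontier E)) (Metric.ball x₀ ρ)).toReal
      ≤ (μHE[2].restrict (frontier E)).real {z | ‖z - x₀‖ ^ 2 ≤ ρ ^ 2} :=
        measureReal_mono fun z hz => le_of_lt ((hball ρ hρ z).1 hz)
    _ ≤ ρ ^ 2 / 16 * Q + 1 / 2 * (196 * ρ ^ 2 * θ * Q) := hA.trans (by gcongr)
    _ = (Q / 16 + 98 * (θ * Q)) * ρ ^ 2 := by ring
    _ ≤ (2 * Real.pi - δ / 6) * ρ ^ 2 := by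
        have h1 : θ * Q ≤ δ / 160000 * 128 := by
          calc θ * Q ≤ θ * 128 := by gcongr; linarith
            _ ≤ _ := by gcongr
        gcongr
        linarith
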